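/- There is a numerical constant $C>0$ such that the following holds. Let $T:\mathbb{C}^n\to\mathbb{C}^N$ be an injective linear map ($n\ge 1$) with Moore--Penrose pseudoinverse $T^\dagger$, let $\|\cdot\|_{p\to q}$ denote the operator norm from $\ell_p$ to $\ell_q$, write $\|\cdot\|=\|\cdot\|_{2\to2}$, and let $\sigma_{\max}(T)$ and $\sigma_{\min}(T)$ be the largest and the smallest of the $n$ singular values of $T$. Let \[ \gamma:=\operatorname*{arg\,min}_{\tilde\gamma>0}\|\tilde\gamma\,T^*T-I_n\|,\qquad \mu:=\max_{1\le k\le n}\max\left\{n\|\gamma^{1/2}Te_k\|_\infty^2,\; n\|\gamma^{-1/2}(T^\dagger)^*e_k\|_\infty^2\right\}, \] where $e_1,\dots,e_n$ is the standard basis of $\mathbb{C}^n$. Let $x\in\mathbb{C}^n$ be such that $Tx$ has at most $s$ nonzero entries, let $\beta\in\mathbb{R}$, and let $m$ be a nonnegative integer with \[ m\ \ge\ \frac{C(1+\beta)\mu s}{1-\|\gamma T^*T-I_n\|}\left[\log N+\log\left(\|T\|_{1\to2}\|T^\dagger\|_{2\to\infty}\right)\right]. \] Let $\omega_1,\dots,\omega_m$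 be independent random indices, uniformly distributed on $\{1,\dots,n\}$, let $\Omega'$ be the set of the distinct values among them, and let $S_{\Omega'}g$ denote the restriction of $g\in\mathbb{C}^n$ to the entries indexed by $\Omega'$. Then, with probability at least $1-e^{-\beta}-3/n$, the following is true: for every $\epsilon\in\mathbb{R}$, every $x^\sharp\in\mathbb{C}^n$ with $\|S_{\Omega'}(x-x^\sharp)\|_2\le\epsilon$, and every minimizer $\hat x$ of \[ \min_{g\in\mathbb{C}^n}\|Tg\|_1\quad\text{subject to}\quad\|S_{\Omega'}g-S_{\Omega'}x^\sharp\|_2\le\epsilon, \] one has \[ \|\hat x-x\|_2\ \le\ \frac{\sigma_{\max}(T)}{\sigma_{\min}(T)}\left\{2+28\sqrt N\left(3n\|T\|_{1\to2}\|T^\dagger\|_{2\to\infty}+1\right)\right\}\epsilon . \] -/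

import Mathlib

open MeasureTheory ProbabilityTheory
open scoped ENNReal Matrix

noncomputable section

namespace AnalysisSparsity

/-- The norm of the vector `v`, indexed by a finite type, in `ℓ_p`. -/
def vecNorm (p : ℝ≥0∞) {ι : Type*} [Fintype ι] (v : ι → ℂ) : ℝ :=
  ‖WithLp.toLp p v‖

/-- The operator norm of the matrix `A`, seen as a linear map from `ℓ_p^n` to `ℓ_q^N`. -/
def opNorm (p q : ℝ≥0∞) [Fact (1 ≤ p)] [Fact (1 ≤ q)] {N n : ℕ}
    (A : Matrix (Fin N) (Fin n) ℂ) : ℝ :=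
  ‖(Matrix.toLpLin p q A).toContinuousLinearMap‖

/-- The four Penrose equations, which characterize the Moore-Penrose pseudoinverse `B` of `A`. -/
def IsMoorePenrose {N n : ℕ} (A : Matrix (Fin N) (Fin n) ℂ)
    (B : Matrix (Fin n) (Fin N) ℂ) : Prop :=
  A * B * A = A ∧ B * A * B = B ∧ (A * B)ᴴ = A * B ∧ (B * A)ᴴ = B * A

/-- The Moore-Penrose pseudoinverse `(A* A)⁻¹ A*` of a matrix `A` with full column rank, that is,
of an injective linear map; it is only used for these. -/
def pinv {N n : ℕ} (A : Matrix (Fin N) (Fin n) ℂ) : Matrix (Fin n) (Fin N) ℂ :=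
  (Aᴴ * A)⁻¹ * Aᴴ

open scoped ComplexOrder in
theorem pinv_mul_self {N n : ℕ} {A : Matrix (Fin N) (Fin n) ℂ}
    (hA : Function.Injective A.mulVec) : pinv A * A = 1 := by
  have h : Function.Injective (Aᴴ * A).mulVec := by
    intro u v huv
    have h0 : (Aᴴ * A) *ᵥ (u - v) = 0 := by
      rw [Matrix.mulVec_sub]
      exact sub_eq_zero.mpr huv
    rw [Matrix.conjTranspose_mul_self_mulVec_eq_zero, Matrix.mulVec_sub] at h0
    exact hA (sub_eq_zero.mp h0)
  have hu : IsUnit (Aᴴ * A) := Matrix.mulVec_injective_iff_isUnit.mp h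
  rw [pinv, Matrix.mul_assoc]
  exact Matrix.nonsing_inv_mul _ ((Matrix.isUnit_iff_isUnit_det _).mp hu)

/-- For an injective `A`, `pinv A` solves the Penrose equations, and nothing else does. -/
theorem isMoorePenrose_iff {N n : ℕ} {A : Matrix (Fin N) (Fin n) ℂ}
    (hA : Function.Injective A.mulVec) (B : Matrix (Fin n) (Fin N) ℂ) :
    IsMoorePenrose A B ↔ B = pinv A := by
  have hl := pinv_mul_self hA
  have hs : (A * pinv A)ᴴ = A * pinv A := by
    simp [pinv, Matrix.conjTranspose_nonsing_inv, Matrix.mul_assoc]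
  constructor
  · rintro ⟨h1, h2, h3, h4⟩
    have hB : B * A = 1 := by
      calc B * A = (pinv A * A) * (B * A) := by rw [hl, Matrix.one_mul]
        _ = pinv A * (A * B * A) := by simp only [Matrix.mul_assoc]
        _ = 1 := by rw [h1, hl]
    have hAB : A * B = A * pinv A := by
      calc A * B = (A * pinv A * A) * B := by rw [Matrix.mul_assoc A, hl, Matrix.mul_one]
        _ = (A * pinv A)ᴴ * (A * B)ᴴ := by rw [hs, h3, Matrix.mul_assoc (A * pinv A)]
        _ = ((A * B * A) * pinv A)ᴴ := by
          rw [← Matrix.conjTranspose_mul]; simp only [Matrix.mul_assoc]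
        _ = A * pinv A := by rw [h1, hs]
    calc B = (pinv A * A) * B := by rw [hl, Matrix.one_mul]
      _ = (pinv A * A) * pinv A := by rw [Matrix.mul_assoc, hAB, ← Matrix.mul_assoc]
      _ = pinv A := by rw [hl, Matrix.one_mul]
  · rintro rfl
    refine ⟨?_, ?_, hs, ?_⟩
    · rw [Matrix.mul_assoc, hl, Matrix.mul_one]
    · rw [hl, Matrix.one_mul]
    · rw [hl, Matrix.conjTranspose_one]

/-- The largest singular value of `A`. -/
def sigmaMax {N n : ℕ} (A : Matrix (Fin N) (Fin n) ℂ) : ℝ :=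
  A.toEuclideanLin.singularValues 0

/-- The smallest of the `n` singular values of a matrix `A` with `n` columns
(counted from 0 and in descending order). -/
def sigmaMin {N n : ℕ} (A : Matrix (Fin N) (Fin n) ℂ) : ℝ :=
  A.toEuclideanLin.singularValues (n - 1)

/-- The spectral norm `‖γ T* T - I‖`. -/
def deviation {N n : ℕ} (T : Matrix (Fin N) (Fin n) ℂ) (γ : ℝ) : ℝ :=
  opNorm 2 2 ((γ : ℂ) • (Tᴴ * T) - 1)

/-- `γ` minimizes `‖γ T* T - I‖` over the positive reals. -/
def IsOptimalScaling {N n : ℕ} (T : Matrix (Fin N) (Fin n) ℂ) (γ : ℝ) : Prop :=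
  0 < γ ∧ ∀ γ' : ℝ, 0 < γ' → deviation T γ ≤ deviation T γ'

/-- The incoherence parameter
`max_k max {n ‖γ^(1/2) T e_k‖_∞ ^ 2, n ‖γ^(-1/2) (T†)* e_k‖_∞ ^ 2}`. -/
def incoherence {N n : ℕ} (T : Matrix (Fin N) (Fin n) ℂ) (γ : ℝ) : ℝ :=
  ⨆ k : Fin n, max
    ((n : ℝ) * vecNorm ∞ (((√γ : ℝ) : ℂ) • (T *ᵥ Pi.single k 1)) ^ 2)
    ((n : ℝ) * vecNorm ∞ ((((√γ)⁻¹ : ℝ) : ℂ) • ((pinv T)ᴴ *ᵥ Pi.single k 1)) ^ 2)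

/-- The number of nonzero entries of a vector. -/
def numNonzero {N : ℕ} (v : Fin N → ℂ) : ℕ :=
  (Finset.univ.filter fun i => v i ≠ 0).card

/-- The random indices `ω 0, …, ω (m - 1)` are independent and uniformly distributed. -/
structure IsIIDUniform {S : Type*} [MeasurableSpace S] (P : Measure S) {m n : ℕ}
    (ω : Fin m → S → Fin n) : Prop where
  measurable : ∀ j, Measurable (ω j)
  indep : iIndepFun ω P
  uniform : ∀ j k, P.real {o | ω j o = k} = 1 / (n : ℝ)

/-- The set of the distinct elements of the multiset `{ω 0, …, ω (m - 1)}`. -/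
def distinctIndices {m n : ℕ} (ω : Fin m → Fin n) : Finset (Fin n) :=
  Finset.univ.image ω

/-- The sampling operator, which keeps the entries of `g` at the indices in `Λ`. -/
def sample {n : ℕ} (Λ : Finset (Fin n)) (g : Fin n → ℂ) : Λ → ℂ :=
  fun k => g k

/-- `g` satisfies the constraint `‖S_Λ g - S_Λ y‖_2 ≤ ε`. -/
def Feasible {n : ℕ} (Λ : Finset (Fin n)) (y : Fin n → ℂ) (ε : ℝ) (g : Fin n → ℂ) : Prop :=
  vecNorm 2 (sample Λ g - sample Λ y) ≤ ε

/-- `g` minimizes `‖T g‖_1` subject to `‖S_Λ g - S_Λ y‖_2 ≤ ε`. -/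
def IsMinimizer {N n : ℕ} (T : Matrix (Fin N) (Fin n) ℂ) (Λ : Finset (Fin n))
    (y : Fin n → ℂ) (ε : ℝ) (g : Fin n → ℂ) : Prop :=
  Feasible Λ y ε g ∧ ∀ g' : Fin n → ℂ, Feasible Λ y ε g' →
    vecNorm 1 (T *ᵥ g) ≤ vecNorm 1 (T *ᵥ g')

end AnalysisSparsity

end

set_option linter.unusedSectionVars false

namespace AnalysisSparsity

/-! Put `w = T (x̂ - x)` and let `J` be the support of `T x`. Minimality puts `w` in a cone: its ℓ₁
mass off `J` is at most `|⟨sign (T x), w⟩|`. If a vector `y` with `T* y` supported on the sampled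
indices nearly equals the sign vector on `J` and has entries at most 1/2 off `J`, then `⟨y, w⟩` sees
only the sampled entries of `x̂ - x`, which have size at most `2ε`; so the off-support mass is
controlled up to a small multiple of `‖w‖`. No local isometry is proved. Instead, each entry of `x̂
- x` is the pairing of `w` with a row of the pseudoinverse, and a certificate is found for each
normalized row restricted to `J` as well. Adding up the `n` entries bounds `‖w‖`, with tolerance `τ`
so small that the error term in `‖w‖` is absorbed (`norm_map_le_of_certificates`).

The certificates come from a golfing scheme that uses one sample per step. With residual `q`, the
certificate gains `η (n ⟨u k, q⟩ v k + (1 - P) q)`, where `u`, `v` are the scaled analysis and dual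
vectors and `P` projects onto the range of `T`. Its mean is `η q`, and `T*` of it lives on the
sampled index `k`. Since the step moves only along the sampled vector and along the kernel of `T*`,
repeated indices do no harm.

Two potentials control this random walk, where `r = ‖q‖ / √|J|` and `Λ = log N`. For an off-support
entry, `exp (24 Λ Re (c y a) + Λ r)` does not grow in mean: the downward drift of `r` pays for the
variance of the entry. For the residual, `r exp (Λ r)` contracts by `exp (-1 / (9600 M))` per step,
where `M = 1 + 2 μ |J|`. The step size is damped while `Λ r > 1`, which the first potential needs,
and the exponential factor in the second makes up for that damping, so that order `M (log N + log
K)` samples suffice, where `K = ‖T‖_{1→2} ‖T†‖_{2→∞}`. Markov's inequality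
(`card_no_certificate_le`) and a union bound over the `n + 1` targets finish the proof. -/

/-! ### One-step estimates for the potentials -/

/-- If increments `X k` are small, with mean at most `-d` and mean square at most `d`,
then their exponentials have mean at most `1`. -/
theorem sum_exp_le_card {ι : Type*} [Fintype ι] {X : ι → ℝ} {d : ℝ} (hX : ∀ k, |X k| ≤ 1)
    (h1 : ∑ k, X k ≤ -d) (h2 : ∑ k, X k ^ 2 ≤ d) :
    ∑ k, Real.exp (X k) ≤ Fintype.card ι := by
  calc ∑ k, Real.exp (X k) ≤ ∑ k, (1 + X k + X k ^ 2) := by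
        refine Finset.sum_le_sum fun k _ => ?_
        have := (abs_le.mp (Real.abs_exp_sub_one_sub_id_le (hX k))).2
        linarith
    _ = Fintype.card ι + ∑ k, X k + ∑ k, X k ^ 2 := by
        simp [Finset.sum_add_distrib]
    _ ≤ _ := by linarith

/-- One step of the dual-certificate iteration, as seen by the residual norm `r`:
the possible next values `r' k` concentrate around `(1 - η) r`. -/
structure IsContractingStep {ι : Type*} [Fintype ι] (M Λ η r : ℝ) (r' : ι → ℝ) : Prop where
  nonneg : 0 ≤ r
  one_le_M : 1 ≤ M
  one_le_Λ : 1 ≤ Λ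
  pos : 0 < η
  small : η * M ≤ 1 / 2400
  small_mul : η * M * (Λ * r) ≤ 1 / 2400
  next_nonneg : ∀ k, 0 ≤ r' k
  sum_le : ∑ k, r' k ≤ Fintype.card ι * ((1 - η / 2) * r)
  abs_le : ∀ k, |r' k - r| ≤ η * M * r
  sum_sq_le : ∑ k, (r' k - r) ^ 2 ≤ Fintype.card ι * (η ^ 2 * M * r ^ 2)

/-- The supermartingale bound for an off-support entry with centred increments `η z k`. The term `Λ
r'` has mean drift at most `-Λ η r / 2`; the total second moment is a multiple of `Λ η r · (η M Λ
r)`, and the damped step makes the last factor small enough for the drift to win. -/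
theorem IsContractingStep.sum_exp_le {ι : Type*} [Fintype ι] {M Λ η r : ℝ} {r' z : ι → ℝ}
    (h : IsContractingStep M Λ η r r') (hz : ∀ k, |z k| ≤ M * r) (hz1 : ∑ k, z k = 0)
    (hz2 : ∑ k, z k ^ 2 ≤ Fintype.card ι * (M * r ^ 2)) :
    ∑ k, Real.exp (24 * Λ * (η * z k) + Λ * r' k) ≤ Fintype.card ι * Real.exp (Λ * r) := by
  obtain ⟨hr, hM, hΛ, hη, hs, hsm, hn, hsum, habs, hsq⟩ := h
  set c : ℝ := (Fintype.card ι : ℝ)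
  have hc : 0 ≤ c := Nat.cast_nonneg _
  have key : ∑ k, Real.exp (24 * Λ * (η * z k) + Λ * (r' k - r)) ≤ c := by
    refine sum_exp_le_card (d := c * (Λ * η * r / 2)) (fun k => ?_) ?_ ?_
    · calc |24 * Λ * (η * z k) + Λ * (r' k - r)|
          ≤ |24 * Λ * (η * z k)| + |Λ * (r' k - r)| := abs_add_le _ _
        _ = 24 * Λ * (η * |z k|) + Λ * |r' k - r| := by
            simp only [abs_mul]
            rw [abs_of_pos hη, abs_of_pos (by linarith : 0 < Λ), abs_of_pos (by norm_num : (0:ℝ) < 24)]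
        _ ≤ 24 * Λ * (η * (M * r)) + Λ * (η * M * r) := by
            gcongr
            · exact hz k
            · exact habs k
        _ = 25 * (η * M * (Λ * r)) := by ring
        _ ≤ 1 := by linarith
    · rw [Finset.sum_add_distrib, ← Finset.mul_sum, ← Finset.mul_sum, ← Finset.mul_sum, hz1,
        Finset.sum_sub_distrib]
      simp only [Finset.sum_const, Finset.card_univ, nsmul_eq_mul]
      have := mul_le_mul_of_nonneg_left hsum (by linarith : 0 ≤ Λ)
      linear_combination this
    · calc ∑ k, (24 * Λ * (η * z k) + Λ * (r' k - r)) ^ 2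
          ≤ ∑ k, (1152 * (Λ * η) ^ 2 * z k ^ 2 + 2 * Λ ^ 2 * (r' k - r) ^ 2) := by
            refine Finset.sum_le_sum fun k _ => ?_
            nlinarith [sq_nonneg (24 * Λ * (η * z k) - Λ * (r' k - r))]
        _ = 1152 * (Λ * η) ^ 2 * ∑ k, z k ^ 2 + 2 * Λ ^ 2 * ∑ k, (r' k - r) ^ 2 := by
            rw [Finset.sum_add_distrib, Finset.mul_sum, Finset.mul_sum]
        _ ≤ 1152 * (Λ * η) ^ 2 * (c * (M * r ^ 2)) +
            2 * Λ ^ 2 * (c * (η ^ 2 * M * r ^ 2)) := by gcongr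
        -- Here 1154 = 2 · 24² + 2; the constant 2400 in the step size exceeds 2 · 1154, so the
        -- result stays below half of `Λ η r`.
        _ = 1154 * (c * (Λ * η * r)) * (η * M * (Λ * r)) := by ring
        _ ≤ 1154 * (c * (Λ * η * r)) * (1 / 2400) := by gcongr
        _ ≤ c * (Λ * η * r / 2) := by
            have : 0 ≤ c * (Λ * η * r) := by positivity
            linarith
  calc ∑ k, Real.exp (24 * Λ * (η * z k) + Λ * r' k)
      = (∑ k, Real.exp (24 * Λ * (η * z k) + Λ * (r' k - r))) * Real.exp (Λ * r) := by
        rw [Finset.sum_mul]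
        refine Finset.sum_congr rfl fun k _ => ?_
        rw [← Real.exp_add]; ring_nf
    _ ≤ _ := by gcongr

/-- The drift of `r` acts on both factors of `r exp (Λ r)`, hence the gain `1 + Λ r`. This gain is
what offsets a step size damped like `1 / (Λ r)`. -/
theorem IsContractingStep.sum_mul_exp_le {ι : Type*} [Fintype ι] {M Λ η r : ℝ} {r' : ι → ℝ}
    (h : IsContractingStep M Λ η r r') :
    ∑ k, r' k * Real.exp (Λ * r' k) ≤
      Fintype.card ι * ((1 - η / 4 * (1 + Λ * r)) * (r * Real.exp (Λ * r))) := by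
  obtain ⟨hr, hM, hΛ, hη, hs, hsm, hn, hsum, habs, hsq⟩ := h
  set c : ℝ := (Fintype.card ι : ℝ)
  have hc : 0 ≤ c := Nat.cast_nonneg _
  have key : ∑ k, r' k * Real.exp (Λ * (r' k - r)) ≤ c * ((1 - η / 4 * (1 + Λ * r)) * r) := by
    have hk : ∀ k, r' k * Real.exp (Λ * (r' k - r)) ≤
        r' k + Λ * r * (r' k - r) + (Λ + 2 * r * Λ ^ 2) * (r' k - r) ^ 2 := by
      intro k
      have hX : |Λ * (r' k - r)| ≤ 1 := by
        rw [abs_mul, abs_of_pos (by linarith : 0 < Λ)]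
        calc Λ * |r' k - r| ≤ Λ * (η * M * r) := by gcongr; exact habs k
          _ = η * M * (Λ * r) := by ring
          _ ≤ 1 := by linarith
      have h1 := (_root_.abs_le.mp (Real.abs_exp_sub_one_sub_id_le hX)).2
      have h2 : r' k ≤ 2 * r := by
        have := (_root_.abs_le.mp (habs k)).2
        nlinarith
      calc r' k * Real.exp (Λ * (r' k - r))
          ≤ r' k * (1 + Λ * (r' k - r) + (Λ * (r' k - r)) ^ 2) := by
            gcongr
            · exact hn k
            · linarith
        _ = r' k + Λ * r * (r' k - r) + Λ * (r' k - r) ^ 2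
              + r' k * (Λ * (r' k - r)) ^ 2 := by ring
        _ ≤ r' k + Λ * r * (r' k - r) + Λ * (r' k - r) ^ 2
              + 2 * r * (Λ * (r' k - r)) ^ 2 := by gcongr
        _ = _ := by ring
    calc ∑ k, r' k * Real.exp (Λ * (r' k - r))
        ≤ ∑ k, (r' k + Λ * r * (r' k - r) + (Λ + 2 * r * Λ ^ 2) * (r' k - r) ^ 2) :=
          Finset.sum_le_sum fun k _ => hk k
      _ = (1 + Λ * r) * ∑ k, r' k - c * (Λ * r * r)
            + (Λ + 2 * r * Λ ^ 2) * ∑ k, (r' k - r) ^ 2 := by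
          simp only [Finset.sum_add_distrib, Finset.mul_sum, mul_sub, Finset.sum_sub_distrib,
            Finset.sum_const, Finset.card_univ, nsmul_eq_mul, add_mul, one_mul]
          ring
      _ ≤ (1 + Λ * r) * (c * ((1 - η / 2) * r)) - c * (Λ * r * r)
            + (Λ + 2 * r * Λ ^ 2) * (c * (η ^ 2 * M * r ^ 2)) := by gcongr
      _ = (1 + Λ * r) * (c * ((1 - η / 2) * r)) - c * (Λ * r * r)
            + (1 + 2 * (Λ * r)) * (c * (η * r)) * (η * M * (Λ * r)) := by ring
      _ ≤ (1 + Λ * r) * (c * ((1 - η / 2) * r)) - c * (Λ * r * r)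
            + (1 + 2 * (Λ * r)) * (c * (η * r)) * (1 / 2400) := by gcongr
      _ ≤ c * ((1 - η / 4 * (1 + Λ * r)) * r) := by
          have e1 : 0 ≤ c * (η * r) := by positivity
          have e2 : 0 ≤ c * (η * r) * (Λ * r) := by positivity
          nlinarith
  calc ∑ k, r' k * Real.exp (Λ * r' k)
      = (∑ k, r' k * Real.exp (Λ * (r' k - r))) * Real.exp (Λ * r) := by
        rw [Finset.sum_mul]
        refine Finset.sum_congr rfl fun k _ => ?_
        rw [mul_assoc, ← Real.exp_add]; ring_nf
    _ ≤ c * ((1 - η / 4 * (1 + Λ * r)) * r) * Real.exp (Λ * r) := by gcongr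
    _ = _ := by ring

/-- The norm of `(1 - η) q - η ξ k` for centred perturbations `ξ k` of bounded variance. -/
theorem isContractingStep_norm {ι E : Type*} [Fintype ι] [NormedAddCommGroup E]
    [InnerProductSpace ℂ E] {M Λ η R : ℝ} {q : E} {ξ : ι → E} (hR : 0 < R)
    (hM : 1 ≤ M) (hΛ : 1 ≤ Λ) (hη : 0 < η) (hs : η * M ≤ 1 / 2400)
    (hsm : η * M * (Λ * (‖q‖ / R)) ≤ 1 / 2400)
    (hξ : ∑ k, ξ k = 0) (hξ1 : ∀ k, ‖ξ k‖ ≤ (M - 1) * ‖q‖)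
    (hξ2 : ∑ k, ‖ξ k‖ ^ 2 ≤ Fintype.card ι * ((M - 1) * ‖q‖ ^ 2)) :
    IsContractingStep M Λ η (‖q‖ / R) fun k => ‖q - (η : ℂ) • (q + ξ k)‖ / R := by
  set c : ℝ := (Fintype.card ι : ℝ)
  have hc : 0 ≤ c := Nat.cast_nonneg _
  have hη1 : η ≤ 1 / 2400 := le_trans (by nlinarith) hs
  have hcross : ∑ k, (inner ℂ q (ξ k)).re = 0 := by
    rw [← Complex.re_sum, ← inner_sum, hξ, inner_zero_right, Complex.zero_re]
  have hdiff : ∀ k, |‖q - (η : ℂ) • (q + ξ k)‖ - ‖q‖| ≤ η * ‖q + ξ k‖ := fun k => by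
    have := abs_norm_sub_norm_le (q - (η : ℂ) • (q + ξ k)) q
    rwa [sub_sub_cancel_left, norm_neg, norm_smul, Complex.norm_real, Real.norm_of_nonneg hη.le]
      at this
  have hsqadd : ∑ k, ‖q + ξ k‖ ^ 2 ≤ c * (M * ‖q‖ ^ 2) := by
    have : ∀ k, ‖q + ξ k‖ ^ 2 = ‖q‖ ^ 2 + 2 * (inner ℂ q (ξ k)).re + ‖ξ k‖ ^ 2 := fun k =>
      norm_add_sq (𝕜 := ℂ) q (ξ k)
    simp only [this, Finset.sum_add_distrib, ← Finset.mul_sum, hcross, Finset.sum_const,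
      Finset.card_univ, nsmul_eq_mul]
    linarith
  have hsqnext : ∑ k, ‖q - (η : ℂ) • (q + ξ k)‖ ^ 2 ≤ c * ((1 - η) * ‖q‖ ^ 2) := by
    have : ∀ k, ‖q - (η : ℂ) • (q + ξ k)‖ ^ 2 =
        ‖q‖ ^ 2 - 2 * η * (‖q‖ ^ 2 + (inner ℂ q (ξ k)).re) + η ^ 2 * ‖q + ξ k‖ ^ 2 := fun k => by
      rw [norm_sub_sq (𝕜 := ℂ), norm_smul, Complex.norm_real, Real.norm_of_nonneg hη.le,
        inner_smul_right, inner_add_right, inner_self_eq_norm_sq_to_K]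
      have : RCLike.re ((η : ℂ) * (((‖q‖ : ℝ) : ℂ) ^ 2 + inner ℂ q (ξ k))) =
          η * (‖q‖ ^ 2 + (inner ℂ q (ξ k)).re) := by
        rw [RCLike.re_eq_complex_re, Complex.re_ofReal_mul, Complex.add_re, ← Complex.ofReal_pow,
          Complex.ofReal_re]
      erw [this]
      ring
    simp only [this, Finset.sum_add_distrib, ← Finset.mul_sum, hcross, Finset.sum_const,
      Finset.card_univ, nsmul_eq_mul, Finset.sum_sub_distrib]
    have h1 := mul_le_mul_of_nonneg_left hsqadd (sq_nonneg η)
    have h2 : η ^ 2 * (c * (M * ‖q‖ ^ 2)) ≤ c * (η * ‖q‖ ^ 2) := by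
      have : η ^ 2 * (c * (M * ‖q‖ ^ 2)) = c * (η * ‖q‖ ^ 2) * (η * M) := by ring
      rw [this]
      exact mul_le_of_le_one_right (by positivity) (by linarith)
    change c * ‖q‖ ^ 2 - 2 * η * (c * ‖q‖ ^ 2 + 0) + _ ≤ _
    linarith
  refine ⟨by positivity, hM, hΛ, hη, hs, hsm, fun k => by positivity, ?_, fun k => ?_, ?_⟩
  · rw [← Finset.sum_div, div_le_iff₀ hR]
    have hcs : (∑ k, ‖q - (η : ℂ) • (q + ξ k)‖) ^ 2 ≤ (c * ((1 - η / 2) * ‖q‖)) ^ 2 := by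
      calc (∑ k, ‖q - (η : ℂ) • (q + ξ k)‖) ^ 2
          ≤ c * ∑ k, ‖q - (η : ℂ) • (q + ξ k)‖ ^ 2 := by
            simpa using sq_sum_le_card_mul_sum_sq (s := Finset.univ)
              (f := fun k => ‖q - (η : ℂ) • (q + ξ k)‖)
        _ ≤ c * (c * ((1 - η) * ‖q‖ ^ 2)) := by gcongr
        -- Half of the mean-square decrease `2η` has gone into the variance, and `1 - η ≤ (1 - η /
        -- 2)²`.
        _ ≤ c ^ 2 * ((1 - η / 2) ^ 2 * ‖q‖ ^ 2) := by
            rw [← mul_assoc, ← sq]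
            gcongr
            nlinarith
        _ = _ := by ring
    have := le_of_sq_le_sq hcs (by have : 0 ≤ 1 - η / 2 := by linarith
                                   positivity)
    calc _ ≤ _ := this
      _ = c * ((1 - η / 2) * (‖q‖ / R)) * R := by field_simp
  · rw [← sub_div, abs_div, abs_of_pos hR, ← mul_div_assoc]
    gcongr
    calc _ ≤ _ := hdiff k
      _ ≤ η * (‖q‖ + ‖ξ k‖) := by gcongr; exact norm_add_le _ _
      _ ≤ η * (‖q‖ + (M - 1) * ‖q‖) := by gcongr; exact hξ1 k
      _ = _ := by ring
  · calc ∑ k, (‖q - (η : ℂ) • (q + ξ k)‖ / R - ‖q‖ / R) ^ 2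
        ≤ ∑ k, η ^ 2 * ‖q + ξ k‖ ^ 2 / R ^ 2 := by
          refine Finset.sum_le_sum fun k _ => ?_
          rw [← sub_div, div_pow, ← mul_pow]
          gcongr ?_ / _
          exact sq_le_sq' (_root_.abs_le.mp (hdiff k)).1 (_root_.abs_le.mp (hdiff k)).2
      _ = η ^ 2 / R ^ 2 * ∑ k, ‖q + ξ k‖ ^ 2 := by
          rw [Finset.mul_sum]; exact Finset.sum_congr rfl fun k _ => by ring
      _ ≤ η ^ 2 / R ^ 2 * (c * (M * ‖q‖ ^ 2)) := by gcongr
      _ = _ := by rw [div_pow]; ring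

/-! ### Coordinate restriction, frame operators and their sampling fluctuations -/

section Frame

variable {ι α : Type*} [Fintype ι] [Fintype α] [DecidableEq α]

/-- Coordinate restriction: keep the entries of `q` at the indices in `J` and zero out the rest. -/
noncomputable def restrict (J : Finset α) : EuclideanSpace ℂ α →ₗ[ℂ] EuclideanSpace ℂ α where
  toFun q := WithLp.toLp 2 fun a => if a ∈ J then q a else 0
  map_add' q q' := by ext a; by_cases h : a ∈ J <;> simp [h]
  map_smul' c q := by ext a; by_cases h : a ∈ J <;> simp [h]

theorem restrict_apply (J : Finset α) (q : EuclideanSpace ℂ α) (a : α) :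
    restrict J q a = if a ∈ J then q a else 0 := rfl

theorem restrict_restrict (J : Finset α) (q : EuclideanSpace ℂ α) :
    restrict J (restrict J q) = restrict J q := by
  ext a; by_cases h : a ∈ J <;> simp [restrict_apply, h]

theorem norm_restrict_sq (J : Finset α) (q : EuclideanSpace ℂ α) :
    ‖restrict J q‖ ^ 2 = ∑ a ∈ J, ‖q a‖ ^ 2 := by
  rw [EuclideanSpace.norm_sq_eq, ← Finset.sum_filter_add_sum_filter_not Finset.univ (· ∈ J)]
  rw [Finset.sum_eq_zero (s := Finset.univ.filter (¬ · ∈ J)), add_zero]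
  · simp only [Finset.filter_mem_eq_inter, Finset.univ_inter]
    exact Finset.sum_congr rfl fun a ha => by simp [restrict_apply, ha]
  · intro a ha
    simp [restrict_apply, (Finset.mem_filter.mp ha).2]

theorem inner_restrict_left (J : Finset α) (p q : EuclideanSpace ℂ α) :
    inner ℂ (restrict J p) q = inner ℂ p (restrict J q) := by
  simp only [PiLp.inner_apply, restrict_apply]
  refine Finset.sum_congr rfl fun a _ => ?_
  by_cases h : a ∈ J <;> simp [h]

/-- The operator `q ↦ ∑ k, ⟪u k, q⟫ v k`. -/
noncomputable def frameOp (u v : ι → EuclideanSpace ℂ α) (q : EuclideanSpace ℂ α) :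
    EuclideanSpace ℂ α :=
  ∑ k, inner ℂ (u k) q • v k

/-- The deviation of the `k`-th rescaled summand of `frameOp u v q` from the total. -/
noncomputable def fluctuation (u v : ι → EuclideanSpace ℂ α) (k : ι)
    (q : EuclideanSpace ℂ α) : EuclideanSpace ℂ α :=
  (Fintype.card ι : ℂ) • (inner ℂ (u k) q • v k) - frameOp u v q

theorem sum_fluctuation (u v : ι → EuclideanSpace ℂ α) (q : EuclideanSpace ℂ α) :
    ∑ k, fluctuation u v k q = 0 := by
  simp only [fluctuation, Finset.sum_sub_distrib, ← Finset.smul_sum, Finset.sum_const,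
    Finset.card_univ, frameOp]
  rw [← Nat.cast_smul_eq_nsmul ℂ, sub_self]

/-- The entries of `u` and `v` are bounded in terms of `μ` and `u` is a Bessel sequence. -/
structure IsIncoherent (u v : ι → EuclideanSpace ℂ α) (μ : ℝ) : Prop where
  left : ∀ k a, Fintype.card ι * ‖u k a‖ ^ 2 ≤ μ
  right : ∀ k a, Fintype.card ι * ‖v k a‖ ^ 2 ≤ μ
  bessel : ∀ q, ∑ k, ‖inner ℂ (u k) q‖ ^ 2 ≤ 2 * ‖q‖ ^ 2

/-- Variance is at most second moment: for uniform `k`, the variable `n c k` has mean `∑ l, c l`. -/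
theorem sum_norm_sq_card_mul_sub_sum_le (c : ι → ℂ) :
    ∑ k, ‖Fintype.card ι * c k - ∑ l, c l‖ ^ 2 ≤ (Fintype.card ι : ℝ) ^ 2 * ∑ k, ‖c k‖ ^ 2 := by
  set n : ℝ := (Fintype.card ι : ℝ)
  set t := ∑ l, c l with ht
  have hk : ∀ k, ‖Fintype.card ι * c k - t‖ ^ 2 =
      n ^ 2 * ‖c k‖ ^ 2 - 2 * n * (c k * (starRingEnd ℂ) t).re + ‖t‖ ^ 2 := fun k => by
    have hre : ((Fintype.card ι : ℂ) * c k * (starRingEnd ℂ) t).re =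
        n * (c k * (starRingEnd ℂ) t).re := by
      rw [mul_assoc, ← Complex.ofReal_natCast, Complex.re_ofReal_mul]
    rw [← Complex.normSq_eq_norm_sq, Complex.normSq_sub, Complex.normSq_mul,
      Complex.normSq_natCast, ← Complex.normSq_eq_norm_sq, ← Complex.normSq_eq_norm_sq, hre]
    ring
  have hcross : ∑ k, (c k * (starRingEnd ℂ) t).re = ‖t‖ ^ 2 := by
    rw [← Complex.re_sum, ← Finset.sum_mul, ← ht, Complex.mul_conj, Complex.ofReal_re,
      Complex.normSq_eq_norm_sq]
  simp only [hk, Finset.sum_add_distrib, Finset.sum_sub_distrib, ← Finset.mul_sum, hcross,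
    Finset.sum_const, Finset.card_univ, nsmul_eq_mul]
  have : 0 ≤ n * ‖t‖ ^ 2 := by positivity
  change n ^ 2 * _ - 2 * n * _ + n * _ ≤ _
  linarith

variable {u v : ι → EuclideanSpace ℂ α} {μ : ℝ}

theorem fluctuation_apply (k : ι) (q : EuclideanSpace ℂ α) (a : α) :
    fluctuation u v k q a =
      Fintype.card ι * (inner ℂ (u k) q * v k a) - ∑ l, inner ℂ (u l) q * v l a := by
  simp [fluctuation, frameOp]

namespace IsIncoherent

theorem nonneg [Nonempty ι] [Nonempty α] (h : IsIncoherent u v μ) : 0 ≤ μ :=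
  le_trans (by positivity) (h.left (Classical.arbitrary ι) (Classical.arbitrary α))

theorem card_mul_norm_inner_sq_le (h : IsIncoherent u v μ) {J : Finset α}
    {q : EuclideanSpace ℂ α} (hq : restrict J q = q) (k : ι) :
    Fintype.card ι * ‖inner ℂ (u k) q‖ ^ 2 ≤ μ * J.card * ‖q‖ ^ 2 := by
  have h1 : ‖inner ℂ (u k) q‖ ^ 2 ≤ (∑ a ∈ J, ‖u k a‖ ^ 2) * ‖q‖ ^ 2 := by
    rw [← norm_restrict_sq, ← mul_pow, ← hq, ← inner_restrict_left, hq]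
    gcongr
    exact norm_inner_le_norm _ _
  calc Fintype.card ι * ‖inner ℂ (u k) q‖ ^ 2
      ≤ Fintype.card ι * ((∑ a ∈ J, ‖u k a‖ ^ 2) * ‖q‖ ^ 2) := by gcongr
    _ = (∑ a ∈ J, Fintype.card ι * ‖u k a‖ ^ 2) * ‖q‖ ^ 2 := by rw [← Finset.mul_sum]; ring
    _ ≤ (∑ _a ∈ J, μ) * ‖q‖ ^ 2 := by gcongr; exact h.left k _
    _ = _ := by simp only [Finset.sum_const, nsmul_eq_mul]; ring

theorem card_mul_norm_entry_le [Nonempty ι] [Nonempty α] (h : IsIncoherent u v μ) {J : Finset α}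
    {q : EuclideanSpace ℂ α} (hq : restrict J q = q) (k : ι) (a : α) :
    ‖(Fintype.card ι : ℂ) * (inner ℂ (u k) q * v k a)‖ ≤ μ * √J.card * ‖q‖ := by
  have hμ := h.nonneg
  refine abs_le_of_sq_le_sq' ?_ (by positivity) |>.2
  rw [norm_mul, norm_mul, Complex.norm_natCast]
  calc (Fintype.card ι * (‖inner ℂ (u k) q‖ * ‖v k a‖)) ^ 2
      = (Fintype.card ι * ‖inner ℂ (u k) q‖ ^ 2) * (Fintype.card ι * ‖v k a‖ ^ 2) := by ring
    _ ≤ (μ * J.card * ‖q‖ ^ 2) * μ :=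
        mul_le_mul (h.card_mul_norm_inner_sq_le hq k) (h.right k a) (by positivity)
          (by positivity)
    _ = _ := by rw [mul_pow, mul_pow, Real.sq_sqrt (Nat.cast_nonneg _)]; ring

theorem norm_sum_entry_le [Nonempty ι] [Nonempty α] (h : IsIncoherent u v μ) {J : Finset α}
    {q : EuclideanSpace ℂ α} (hq : restrict J q = q) (a : α) :
    ‖∑ l, inner ℂ (u l) q * v l a‖ ≤ μ * √J.card * ‖q‖ := by
  have hn : (0 : ℝ) < Fintype.card ι := by exact_mod_cast Fintype.card_pos
  refine le_of_mul_le_mul_left ?_ hn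
  calc Fintype.card ι * ‖∑ l, inner ℂ (u l) q * v l a‖
      = ‖∑ l, (Fintype.card ι : ℂ) * (inner ℂ (u l) q * v l a)‖ := by
        rw [← Finset.mul_sum, norm_mul, Complex.norm_natCast]
    _ ≤ ∑ _l : ι, μ * √J.card * ‖q‖ :=
        norm_sum_le_of_le _ fun l _ => h.card_mul_norm_entry_le hq l a
    _ = _ := by simp

theorem norm_fluctuation_apply_le [Nonempty ι] [Nonempty α] (h : IsIncoherent u v μ)
    {J : Finset α} {q : EuclideanSpace ℂ α} (hq : restrict J q = q) (k : ι) (a : α) :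
    ‖fluctuation u v k q a‖ ≤ 2 * μ * √J.card * ‖q‖ := by
  rw [fluctuation_apply]
  calc _ ≤ _ := norm_sub_le _ _
    _ ≤ _ := add_le_add (h.card_mul_norm_entry_le hq k a) (h.norm_sum_entry_le hq a)
    _ = _ := by ring

/-- Bounding `v k a` by incoherence and summing over `u k` by the Bessel inequality avoids the
factor `|J|` that squaring the pointwise bound would cost. -/
theorem sum_norm_fluctuation_apply_sq_le (h : IsIncoherent u v μ)
    (q : EuclideanSpace ℂ α) (a : α) (hμ : 0 ≤ μ) :
    ∑ k, ‖fluctuation u v k q a‖ ^ 2 ≤ Fintype.card ι * (2 * μ * ‖q‖ ^ 2) := by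
  simp only [fluctuation_apply]
  calc _ ≤ _ := sum_norm_sq_card_mul_sub_sum_le _
    _ = Fintype.card ι * ∑ k, ‖inner ℂ (u k) q‖ ^ 2 * (Fintype.card ι * ‖v k a‖ ^ 2) := by
        rw [sq, mul_assoc, Finset.mul_sum]
        congr 1
        exact Finset.sum_congr rfl fun k _ => by rw [norm_mul]; ring
    _ ≤ Fintype.card ι * ∑ k, ‖inner ℂ (u k) q‖ ^ 2 * μ := by
        gcongr with k; exact h.right k a
    _ ≤ Fintype.card ι * ((2 * ‖q‖ ^ 2) * μ) := by
        rw [← Finset.sum_mul]; gcongr; exact h.bessel q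
    _ = _ := by ring

theorem norm_restrict_fluctuation_le [Nonempty ι] [Nonempty α] (h : IsIncoherent u v μ)
    {J : Finset α} {q : EuclideanSpace ℂ α} (hq : restrict J q = q) (k : ι) :
    ‖restrict J (fluctuation u v k q)‖ ≤ 2 * μ * J.card * ‖q‖ := by
  have hμ := h.nonneg
  refine abs_le_of_sq_le_sq' ?_ (by positivity) |>.2
  rw [norm_restrict_sq]
  calc ∑ a ∈ J, ‖fluctuation u v k q a‖ ^ 2 ≤ ∑ _a ∈ J, (2 * μ * √J.card * ‖q‖) ^ 2 := by
        gcongr; exact h.norm_fluctuation_apply_le hq k _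
    _ = _ := by
        rw [Finset.sum_const, nsmul_eq_mul, mul_pow, mul_pow, Real.sq_sqrt (Nat.cast_nonneg _)]
        ring

theorem sum_norm_restrict_fluctuation_sq_le (h : IsIncoherent u v μ)
    (J : Finset α) (q : EuclideanSpace ℂ α) (hμ : 0 ≤ μ) :
    ∑ k, ‖restrict J (fluctuation u v k q)‖ ^ 2 ≤
      Fintype.card ι * (2 * μ * J.card * ‖q‖ ^ 2) := by
  simp only [norm_restrict_sq]
  rw [Finset.sum_comm]
  calc _ ≤ ∑ _a ∈ J, Fintype.card ι * (2 * μ * ‖q‖ ^ 2) :=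
        Finset.sum_le_sum fun a _ => h.sum_norm_fluctuation_apply_sq_le q a hμ
    _ = _ := by rw [Finset.sum_const, nsmul_eq_mul]; ring

end IsIncoherent

/-! ### The dual-certificate iteration -/

/-- The step size, damped while the relative residual norm `‖q‖ / √s` is large. -/
noncomputable def stepSize (M Λ s : ℝ) (q : EuclideanSpace ℂ α) : ℝ :=
  1 / (2400 * M * max 1 (Λ * (‖q‖ / √s)))

/-- The last bound is the point of the damping rule: it makes the contraction of the residual
potential uniform in the size of the residual. -/
theorem stepSize_spec {M Λ : ℝ} (s : ℝ) (hM : 1 ≤ M) (hΛ : 1 ≤ Λ) (q : EuclideanSpace ℂ α) :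
    0 < stepSize M Λ s q ∧ stepSize M Λ s q * M ≤ 1 / 2400 ∧
      stepSize M Λ s q * M * (Λ * (‖q‖ / √s)) ≤ 1 / 2400 ∧
      1 / (2400 * M) ≤ stepSize M Λ s q * (1 + Λ * (‖q‖ / √s)) := by
  set t := Λ * (‖q‖ / √s)
  have ht : 0 ≤ t := by positivity
  have hm : 1 ≤ max 1 t := le_max_left _ _
  have hm' : t ≤ max 1 t := le_max_right _ _
  have hm'' : max 1 t ≤ 1 + t := max_le (by linarith) (by linarith)
  have hM0 : 0 < M := by linarith
  have e : stepSize M Λ s q * M = 1 / 2400 * (1 / max 1 t) := by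
    rw [stepSize]
    change 1 / (2400 * M * max 1 t) * M = _
    field_simp
  refine ⟨by rw [stepSize]; positivity, ?_, ?_, ?_⟩
  · rw [e]
    exact mul_le_of_le_one_right (by norm_num) ((div_le_one (by positivity)).mpr hm)
  · rw [e, mul_assoc, one_div_mul_eq_div (max 1 t)]
    exact mul_le_of_le_one_right (by norm_num) ((div_le_one (by positivity)).mpr hm')
  · rw [stepSize, one_div_mul_eq_div]
    change _ ≤ (1 + t) / (2400 * M * max 1 t)
    rw [div_le_div_iff₀ (by positivity) (by positivity)]
    nlinarith

/-- One step of the iteration on pairs (residual, certificate), using the sample `k`. -/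
noncomputable def certStep (u v : ι → EuclideanSpace ℂ α) (J : Finset α) (M Λ : ℝ)
    (st : EuclideanSpace ℂ α × EuclideanSpace ℂ α) (k : ι) :
    EuclideanSpace ℂ α × EuclideanSpace ℂ α :=
  -- With `P` the frame operator, `q + fluctuation` is `n ⟨u k, q⟩ v k + (q - P q)`. It has mean
  -- `q`, and the part `q - P q` is annihilated by every functional that is unchanged by `P`.
  let g := (stepSize M Λ J.card st.1 : ℂ) • (st.1 + fluctuation u v k st.1)
  (st.1 - restrict J g, st.2 + g)

/-- Run a randomized iteration along a sequence of samples. -/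
def runSteps {σ : Type*} (F : σ → ι → σ) : (m : ℕ) → (Fin m → ι) → σ → σ
  | 0, _, st => st
  | m + 1, ω, st => runSteps F m (Fin.tail ω) (F st (ω 0))

theorem runSteps_induction {σ : Type*} {F : σ → ι → σ} {p : σ → Prop} :
    ∀ (m : ℕ) (ω : Fin m → ι) (st : σ), p st → (∀ st, p st → ∀ j, p (F st (ω j))) →
      p (runSteps F m ω st)
  | 0, _, _, h, _ => h
  | m + 1, ω, st, h, hF =>
    runSteps_induction m (Fin.tail ω) _ (hF st h 0) fun st h j => hF st h j.succ

/-- Iterated conditional expectation in counting form: condition on the first sample, apply the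
induction hypothesis to the state it produces, then use the one-step bound. -/
theorem sum_runSteps_le {σ : Type*} {F : σ → ι → σ} {p : σ → Prop} {φ : σ → ℝ} {θ : ℝ}
    (hθ : 0 ≤ θ) (hp : ∀ st k, p st → p (F st k))
    (hφ : ∀ st, p st → ∑ k, φ (F st k) ≤ θ * φ st) :
    ∀ (m : ℕ) (st : σ), p st → ∑ ω : Fin m → ι, φ (runSteps F m ω st) ≤ θ ^ m * φ st
  | 0, st, _ => by simp [runSteps]
  | m + 1, st, h => by
    rw [← (Fin.consEquiv fun _ : Fin (m + 1) => ι).sum_comp, Fintype.sum_prod_type]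
    calc ∑ k, ∑ ω : Fin m → ι, φ (runSteps F m ω (F st k))
        ≤ ∑ k, θ ^ m * φ (F st k) :=
          Finset.sum_le_sum fun k _ => sum_runSteps_le hθ hp hφ m _ (hp st k h)
      _ ≤ θ ^ m * (θ * φ st) := by
          rw [← Finset.mul_sum]; gcongr; exact hφ st h
      _ = _ := by ring

/-- Markov's inequality for counting. -/
theorem card_filter_mul_le_sum {β : Type*} [Fintype β] (p : β → Prop) [DecidablePred p]
    {f : β → ℝ} {t : ℝ} (hf : ∀ b, 0 ≤ f b) (h : ∀ b, p b → t ≤ f b) :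
    ((Finset.univ.filter p).card : ℝ) * t ≤ ∑ b, f b := by
  calc ((Finset.univ.filter p).card : ℝ) * t = ∑ _b ∈ Finset.univ.filter p, t := by simp
    _ ≤ ∑ b ∈ Finset.univ.filter p, f b :=
        Finset.sum_le_sum fun b hb => h b (Finset.mem_filter.mp hb).2
    _ ≤ _ := Finset.sum_le_sum_of_subset_of_nonneg (Finset.subset_univ _) fun b _ _ => hf b

variable {J : Finset α} {M Λ : ℝ}

theorem restrict_certStep {st : EuclideanSpace ℂ α × EuclideanSpace ℂ α} (k : ι)
    (hq : restrict J st.1 = st.1) :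
    restrict J (certStep u v J M Λ st k).1 = (certStep u v J M Λ st k).1 := by
  simp only [certStep, map_sub, restrict_restrict, hq]

theorem isContractingStep_certStep [Nonempty ι] [Nonempty α] (h : IsIncoherent u v μ)
    (hJ : J.Nonempty) (hM : M = 1 + 2 * μ * J.card) (hΛ : 1 ≤ Λ)
    {st : EuclideanSpace ℂ α × EuclideanSpace ℂ α} (hq : restrict J st.1 = st.1) :
    IsContractingStep M Λ (stepSize M Λ J.card st.1) (‖st.1‖ / √J.card)
      fun k => ‖(certStep u v J M Λ st k).1‖ / √J.card := by
  have hμ := h.nonneg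
  have hM1 : 1 ≤ M := by rw [hM]; exact le_add_of_nonneg_right (by positivity)
  have hM2 : M - 1 = 2 * μ * J.card := by rw [hM]; ring
  have hs : (0 : ℝ) < √J.card := Real.sqrt_pos.mpr (by exact_mod_cast hJ.card_pos)
  obtain ⟨h1, h2, h3, -⟩ := stepSize_spec (J.card : ℝ) hM1 hΛ st.1
  have := isContractingStep_norm (q := st.1)
    (ξ := fun k => restrict J (fluctuation u v k st.1)) hs hM1 hΛ h1 h2 h3
    (by rw [← map_sum, sum_fluctuation, map_zero])
    (fun k => by rw [hM2]; exact h.norm_restrict_fluctuation_le hq k)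
    (by rw [hM2]; exact h.sum_norm_restrict_fluctuation_sq_le J _ hμ)
  simpa only [certStep, map_smul, map_add, hq] using this

/-- The potential that controls the certificate in the direction `c` at the entry `a`. -/
noncomputable def entryPotential (J : Finset α) (Λ : ℝ) (a : α) (c : ℂ)
    (st : EuclideanSpace ℂ α × EuclideanSpace ℂ α) : ℝ :=
  Real.exp (24 * Λ * (c * st.2 a).re + Λ * (‖st.1‖ / √J.card))

/-- The potential that controls the residual. -/
noncomputable def residualPotential (J : Finset α) (Λ : ℝ)
    (st : EuclideanSpace ℂ α × EuclideanSpace ℂ α) : ℝ :=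
  ‖st.1‖ / √J.card * Real.exp (Λ * (‖st.1‖ / √J.card))

/-- Off `J` the residual vanishes, so the entry of the certificate moves by a pure fluctuation,
which is centred. In units of `r = ‖q‖ / √|J|` its size and mean square are at most `2 μ |J| r` and
`2 μ |J| r²`, as `sum_exp_le` requires. -/
theorem sum_entryPotential_certStep_le [Nonempty ι] [Nonempty α] (h : IsIncoherent u v μ)
    (hJ : J.Nonempty) (hM : M = 1 + 2 * μ * J.card) (hΛ : 1 ≤ Λ) {a : α} (ha : a ∉ J) {c : ℂ}
    (hc : ‖c‖ = 1) {st : EuclideanSpace ℂ α × EuclideanSpace ℂ α} (hq : restrict J st.1 = st.1) :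
    ∑ k, entryPotential J Λ a c (certStep u v J M Λ st k) ≤
      Fintype.card ι * entryPotential J Λ a c st := by
  have hμ := h.nonneg
  have hstep := isContractingStep_certStep h hJ hM hΛ hq
  have hs0 : (0 : ℝ) < J.card := by exact_mod_cast hJ.card_pos
  have hs : (0 : ℝ) < √J.card := Real.sqrt_pos.mpr hs0
  have hre : ∀ k, |(c * fluctuation u v k st.1 a).re| ≤ ‖fluctuation u v k st.1 a‖ := fun k =>
    (Complex.abs_re_le_norm _).trans (by rw [norm_mul, hc, one_mul])
  have hqa : st.1 a = 0 := by rw [← hq, restrict_apply, if_neg ha]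
  have hsum := hstep.sum_exp_le (z := fun k => (c * fluctuation u v k st.1 a).re) (fun k => ?_) ?_ ?_
  · have e : ∀ k, entryPotential J Λ a c (certStep u v J M Λ st k) =
        Real.exp (24 * Λ * (c * st.2 a).re) * Real.exp (24 * Λ * (stepSize M Λ J.card st.1 *
          (c * fluctuation u v k st.1 a).re) +
          Λ * (‖(certStep u v J M Λ st k).1‖ / √J.card)) := fun k => by
      rw [entryPotential, ← Real.exp_add]
      congr 1
      have : (c * (certStep u v J M Λ st k).2 a).re =
          (c * st.2 a).re + stepSize M Λ J.card st.1 * (c * fluctuation u v k st.1 a).re := by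
        simp only [certStep, PiLp.add_apply, PiLp.smul_apply, hqa, smul_eq_mul, zero_add, mul_add,
          Complex.add_re]
        rw [mul_left_comm, Complex.re_ofReal_mul]
      rw [this]; ring
    rw [Finset.sum_congr rfl fun k _ => e k, ← Finset.mul_sum, entryPotential, Real.exp_add,
      mul_left_comm]
    gcongr
  · refine (hre k).trans ((h.norm_fluctuation_apply_le hq k a).trans ?_)
    calc 2 * μ * √J.card * ‖st.1‖ = 2 * μ * J.card * (‖st.1‖ / √J.card) := by
          nth_rewrite 2 [← Real.sq_sqrt hs0.le]; field_simp
      _ ≤ M * (‖st.1‖ / √J.card) := by gcongr; linarith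
  · rw [← Complex.re_sum, ← Finset.mul_sum]
    have : ∑ k, fluctuation u v k st.1 a = (∑ k, fluctuation u v k st.1) a := by simp
    rw [this, sum_fluctuation]; simp
  · calc ∑ k, (c * fluctuation u v k st.1 a).re ^ 2
        ≤ ∑ k, ‖fluctuation u v k st.1 a‖ ^ 2 := Finset.sum_le_sum fun k _ =>
          sq_le_sq' (abs_le.mp (hre k)).1 (abs_le.mp (hre k)).2
      _ ≤ _ := h.sum_norm_fluctuation_apply_sq_le _ a hμ
      _ = Fintype.card ι * (2 * μ * J.card * (‖st.1‖ / √J.card) ^ 2) := by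
          rw [div_pow, Real.sq_sqrt hs0.le]; field_simp
      _ ≤ _ := by gcongr; linarith

theorem sum_residualPotential_certStep_le [Nonempty ι] [Nonempty α] (h : IsIncoherent u v μ)
    (hJ : J.Nonempty) (hM : M = 1 + 2 * μ * J.card) (hΛ : 1 ≤ Λ)
    {st : EuclideanSpace ℂ α × EuclideanSpace ℂ α} (hq : restrict J st.1 = st.1) :
    ∑ k, residualPotential J Λ (certStep u v J M Λ st k) ≤
      Fintype.card ι * Real.exp (-(1 / (9600 * M))) * residualPotential J Λ st := by
  have hμ := h.nonneg
  have hM1 : 1 ≤ M := by rw [hM]; exact le_add_of_nonneg_right (by positivity)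
  have hstep := isContractingStep_certStep h hJ hM hΛ hq
  obtain ⟨-, -, -, h4⟩ := stepSize_spec (J.card : ℝ) hM1 hΛ st.1
  refine hstep.sum_mul_exp_le.trans ?_
  rw [mul_assoc]
  change _ * (_ * residualPotential J Λ st) ≤ _
  have h0 : 0 ≤ residualPotential J Λ st := by rw [residualPotential]; positivity
  gcongr
  have h5 : 1 / (9600 * M) = 1 / (2400 * M) / 4 := by field_simp; norm_num
  have := Real.add_one_le_exp (-(1 / (9600 * M)))
  linarith

/-- The larger of `|Re z|` and `|Im z|` is at least `‖z‖ / √2`, and `1 / (2 √2) > 1 / 3`. Four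
directions thus replace the modulus in the exponential moment. -/
theorem exists_third_le_re_mul {z : ℂ} (hz : 1 / 2 < ‖z‖) :
    ∃ j : Fin 4, 1 / 3 ≤ (Complex.I ^ (j : ℕ) * z).re := by
  by_contra! H
  have h0 := H 0
  have h1 := H 1
  have h2 := H 2
  have h3 := H 3
  have hI : Complex.I ^ 3 = -Complex.I := by rw [pow_succ, Complex.I_sq]; ring
  simp [hI] at h0 h1 h2 h3
  have hsq : ‖z‖ ^ 2 = z.re * z.re + z.im * z.im := by
    rw [← Complex.normSq_eq_norm_sq, Complex.normSq_apply]
  nlinarith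

end Frame

/-! ### Probability that the iteration yields a certificate -/

section Certificate

variable {ι α : Type*} [Fintype ι] [Fintype α] [DecidableEq α]
  {u v : ι → EuclideanSpace ℂ α} {μ : ℝ} {J : Finset α} {M Λ : ℝ}

/-- `y` is an inexact dual certificate for `q₀` on `J` that is invisible to the functionals `L k`
with `k` outside the sampled set `A`. -/
structure IsCertificate (L : ι → EuclideanSpace ℂ α →ₗ[ℂ] ℂ) (J : Finset α)
    (q₀ : EuclideanSpace ℂ α) (τ : ℝ) (A : Set ι) (y : EuclideanSpace ℂ α) : Prop where
  eq_zero : ∀ k ∉ A, L k y = 0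
  on_support : ‖restrict J y - q₀‖ ≤ τ
  off_support : ∀ a ∉ J, ‖y a‖ ≤ 1 / 2

/-- Both parts of the step are invisible to `L k`: the sampled vector `v j` because `k ≠ j`, the
correction `q - P q` because `L k ∘ P = L k`. -/
theorem map_certStep_snd {L : ι → EuclideanSpace ℂ α →ₗ[ℂ] ℂ}
    (hLv : ∀ k l, k ≠ l → L k (v l) = 0) (hLP : ∀ k q, L k (frameOp u v q) = L k q)
    (st : EuclideanSpace ℂ α × EuclideanSpace ℂ α) {j k : ι} (hjk : k ≠ j) :
    L k (certStep u v J M Λ st j).2 = L k st.2 := by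
  simp only [certStep, fluctuation, map_add, map_smul, map_sub, hLP, hLv k j hjk]
  simp

theorem sum_entryPotential_runSteps_le [Nonempty ι] [Nonempty α] (h : IsIncoherent u v μ)
    (hJ : J.Nonempty) (hM : M = 1 + 2 * μ * J.card) (hΛ : 1 ≤ Λ) {a : α} (ha : a ∉ J) {c : ℂ}
    (hc : ‖c‖ = 1) {q₀ : EuclideanSpace ℂ α} (hq : restrict J q₀ = q₀) (hq1 : ‖q₀‖ ≤ √J.card)
    (m : ℕ) :
    ∑ ω : Fin m → ι, entryPotential J Λ a c (runSteps (certStep u v J M Λ) m ω (q₀, 0)) ≤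
      (Fintype.card ι : ℝ) ^ m * Real.exp Λ := by
  have hs : (0 : ℝ) < √J.card := Real.sqrt_pos.mpr (by exact_mod_cast hJ.card_pos)
  refine (sum_runSteps_le (p := fun st => restrict J st.1 = st.1) (Nat.cast_nonneg _)
    (fun st k => restrict_certStep k)
    (fun st => sum_entryPotential_certStep_le h hJ hM hΛ ha hc) m (q₀, 0) hq).trans ?_
  gcongr
  rw [entryPotential]
  have : ‖q₀‖ / √J.card ≤ 1 := (div_le_one hs).mpr hq1
  gcongr
  simp only [PiLp.zero_apply, mul_zero, Complex.zero_re, zero_add]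
  nlinarith

theorem sum_residualPotential_runSteps_le [Nonempty ι] [Nonempty α] (h : IsIncoherent u v μ)
    (hJ : J.Nonempty) (hM : M = 1 + 2 * μ * J.card) (hΛ : 1 ≤ Λ)
    {q₀ : EuclideanSpace ℂ α} (hq : restrict J q₀ = q₀) (hq1 : ‖q₀‖ ≤ √J.card) (m : ℕ) :
    ∑ ω : Fin m → ι, residualPotential J Λ (runSteps (certStep u v J M Λ) m ω (q₀, 0)) ≤
      (Fintype.card ι : ℝ) ^ m * Real.exp (Λ - m / (9600 * M)) := by
  have hs : (0 : ℝ) < √J.card := Real.sqrt_pos.mpr (by exact_mod_cast hJ.card_pos)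
  refine (sum_runSteps_le (p := fun st => restrict J st.1 = st.1) (by positivity)
    (fun st k => restrict_certStep k)
    (fun st => sum_residualPotential_certStep_le h hJ hM hΛ) m (q₀, 0) hq).trans ?_
  rw [mul_pow, ← Real.exp_nat_mul, mul_assoc, sub_eq_add_neg, add_comm Λ, Real.exp_add]
  have : ‖q₀‖ / √J.card ≤ 1 := (div_le_one hs).mpr hq1
  have e : (m : ℝ) * -(1 / (9600 * M)) = -(m / (9600 * M)) := by ring
  rw [e]
  gcongr
  rw [residualPotential]
  calc ‖q₀‖ / √J.card * Real.exp (Λ * (‖q₀‖ / √J.card)) ≤ 1 * Real.exp (Λ * 1) := by gcongr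
    _ = _ := by rw [one_mul, mul_one]

-- Every failure makes one of the weighted potentials at least 1, so Markov's inequality applies to
-- their sum. The first term is the union over off-support entries and four directions; the second
-- is the residual exceeding `τ`.
open Classical in
theorem card_no_certificate_le [Nonempty ι] [Nonempty α] (h : IsIncoherent u v μ)
    (hJ : J.Nonempty) (hM : M = 1 + 2 * μ * J.card) (hΛ : 1 ≤ Λ)
    {L : ι → EuclideanSpace ℂ α →ₗ[ℂ] ℂ}
    (hLv : ∀ k l, k ≠ l → L k (v l) = 0) (hLP : ∀ k q, L k (frameOp u v q) = L k q)
    {q₀ : EuclideanSpace ℂ α} (hq : restrict J q₀ = q₀) (hq1 : ‖q₀‖ ≤ √J.card)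
    {τ : ℝ} (hτ : 0 < τ) (m : ℕ) :
    ((Finset.univ.filter fun ω : Fin m → ι =>
        ¬ ∃ y, IsCertificate L J q₀ τ (Set.range ω) y).card : ℝ) ≤
      (Fintype.card ι : ℝ) ^ m * (4 * Fintype.card α * Real.exp (-(7 * Λ)) +
        √J.card / τ * Real.exp (Λ - m / (9600 * M))) := by
  set run := fun ω : Fin m → ι => runSteps (certStep u v J M Λ) m ω (q₀, 0) with hrun
  have hs : (0 : ℝ) < √J.card := Real.sqrt_pos.mpr (by exact_mod_cast hJ.card_pos)
  have hΛ0 : 0 < Λ := by linarith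
  have hE : ∀ ω a c, 0 ≤ entryPotential J Λ a c (run ω) := fun ω a c => (Real.exp_pos _).le
  have hR : ∀ ω, 0 ≤ residualPotential J Λ (run ω) := fun ω => by
    rw [residualPotential]; positivity
  set f : (Fin m → ι) → ℝ := fun ω =>
    (∑ a ∈ Jᶜ, ∑ j : Fin 4, entryPotential J Λ a (Complex.I ^ (j : ℕ)) (run ω)) *
      Real.exp (-(8 * Λ)) + √J.card / τ * residualPotential J Λ (run ω) with hf
  have hf0 : ∀ ω, 0 ≤ f ω := fun ω => add_nonneg
    (mul_nonneg (Finset.sum_nonneg fun a _ => Finset.sum_nonneg fun j _ => hE _ _ _)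
      (Real.exp_pos _).le) (mul_nonneg (by positivity) (hR ω))
  have hbad : ∀ ω : Fin m → ι, (¬ ∃ y, IsCertificate L J q₀ τ (Set.range ω) y) → 1 ≤ f ω := by
    intro ω hω
    by_contra! hlt
    refine hω ⟨(run ω).2, ?_, ?_, ?_⟩
    · intro k hk
      refine runSteps_induction (p := fun st => L k st.2 = 0) m ω (q₀, 0) (map_zero _)
        fun st hst j => ?_
      rw [map_certStep_snd hLv hLP st fun hkj => hk ⟨j, hkj.symm⟩, hst]
    -- Residual plus certificate on `J` is conserved, so a small residual is the same as accuracy on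
    -- the support.
    · have hinv : (run ω).1 + restrict J (run ω).2 = q₀ := by
        refine runSteps_induction (p := fun st => st.1 + restrict J st.2 = q₀) m ω (q₀, 0)
          (by simp) fun st hst j => ?_
        simpa [certStep] using hst
      rw [← hinv, sub_add_cancel_right, norm_neg]
      by_contra! hτq
      have h1 : τ / √J.card ≤ residualPotential J Λ (run ω) := by
        rw [residualPotential]
        calc τ / √J.card ≤ ‖(run ω).1‖ / √J.card * 1 := by rw [mul_one]; gcongr
          _ ≤ _ := by
            gcongr
            exact Real.one_le_exp (by positivity)
      have h2 : 1 ≤ √J.card / τ * residualPotential J Λ (run ω) := by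
        calc (1 : ℝ) = √J.card / τ * (τ / √J.card) := by field_simp
          _ ≤ _ := by gcongr
      have h3 : 0 ≤ (∑ a ∈ Jᶜ, ∑ j : Fin 4, entryPotential J Λ a (Complex.I ^ (j : ℕ)) (run ω)) *
          Real.exp (-(8 * Λ)) := mul_nonneg
            (Finset.sum_nonneg fun a _ => Finset.sum_nonneg fun j _ => hE _ _ _) (Real.exp_pos _).le
      linarith
    · intro a ha
      by_contra! hya
      -- A real part of at least 1/3 gives exponent `24 Λ / 3 = 8 Λ`, against an initial potential
      -- of at most `exp Λ`.
      obtain ⟨j, hj⟩ := exists_third_le_re_mul hya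
      have h1 : Real.exp (8 * Λ) ≤ entryPotential J Λ a (Complex.I ^ (j : ℕ)) (run ω) := by
        rw [entryPotential]
        gcongr
        have : 0 ≤ Λ * (‖(run ω).1‖ / √J.card) := by positivity
        nlinarith
      have h2 : entryPotential J Λ a (Complex.I ^ (j : ℕ)) (run ω) ≤
          ∑ a ∈ Jᶜ, ∑ j : Fin 4, entryPotential J Λ a (Complex.I ^ (j : ℕ)) (run ω) :=
        (Finset.single_le_sum (f := fun j : Fin 4 => entryPotential J Λ a (Complex.I ^ (j : ℕ))
            (run ω)) (fun j _ => hE _ _ _) (Finset.mem_univ j)).trans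
          (Finset.single_le_sum (f := fun a => ∑ j : Fin 4,
            entryPotential J Λ a (Complex.I ^ (j : ℕ)) (run ω))
            (fun a _ => Finset.sum_nonneg fun j _ => hE _ _ _) (Finset.mem_compl.mpr ha))
      have h3 : 1 ≤ (∑ a ∈ Jᶜ, ∑ j : Fin 4,
          entryPotential J Λ a (Complex.I ^ (j : ℕ)) (run ω)) * Real.exp (-(8 * Λ)) := by
        calc (1 : ℝ) = Real.exp (8 * Λ) * Real.exp (-(8 * Λ)) := by rw [← Real.exp_add]; simp
          _ ≤ _ := by gcongr; exact h1.trans h2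
      have h4 : 0 ≤ √J.card / τ * residualPotential J Λ (run ω) :=
        mul_nonneg (by positivity) (hR ω)
      linarith
  have hmarkov := card_filter_mul_le_sum
    (fun ω : Fin m → ι => ¬ ∃ y, IsCertificate L J q₀ τ (Set.range ω) y) hf0 hbad
  rw [mul_one] at hmarkov
  refine hmarkov.trans ?_
  calc ∑ ω, f ω = (∑ a ∈ Jᶜ, ∑ j : Fin 4, ∑ ω,
          entryPotential J Λ a (Complex.I ^ (j : ℕ)) (run ω)) * Real.exp (-(8 * Λ)) +
        √J.card / τ * ∑ ω, residualPotential J Λ (run ω) := by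
        simp only [hf, Finset.sum_add_distrib, ← Finset.sum_mul, ← Finset.mul_sum]
        rw [Finset.sum_comm]
        simp only [Finset.sum_comm (s := (Finset.univ : Finset (Fin m → ι)))
          (t := (Finset.univ : Finset (Fin 4)))]
    _ ≤ (∑ _a ∈ Jᶜ, ∑ _j : Fin 4, (Fintype.card ι : ℝ) ^ m * Real.exp Λ) * Real.exp (-(8 * Λ)) +
        √J.card / τ * ((Fintype.card ι : ℝ) ^ m * Real.exp (Λ - m / (9600 * M))) := by
        gcongr with a ha j
        · exact sum_entryPotential_runSteps_le h hJ hM hΛ (Finset.mem_compl.mp ha) (by simp) hq hq1 m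
        · exact sum_residualPotential_runSteps_le h hJ hM hΛ hq hq1 m
    _ = (Fintype.card ι : ℝ) ^ m * (4 * (Jᶜ.card : ℝ) * (Real.exp Λ * Real.exp (-(8 * Λ))) +
        √J.card / τ * Real.exp (Λ - m / (9600 * M))) := by
        simp only [Finset.sum_const, Finset.card_univ, Fintype.card_fin, nsmul_eq_mul]
        push_cast
        ring
    _ ≤ _ := by
        rw [← Real.exp_add, show Λ + -(8 * Λ) = -(7 * Λ) by ring]
        gcongr
        exact_mod_cast Finset.card_le_univ _

end Certificate

/-! ### Extreme singular values as norm bounds -/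

section SingularValues

variable {E F : Type*} [NormedAddCommGroup E] [InnerProductSpace ℂ E] [FiniteDimensional ℂ E]
  [NormedAddCommGroup F] [InnerProductSpace ℂ F] [FiniteDimensional ℂ F]

theorem norm_inner_self_eq (z : E) : ‖inner ℂ z z‖ = ‖z‖ * ‖z‖ := by
  rw [inner_self_eq_norm_sq_to_K]; simp [sq]

/-- Expand `⟪h, A* A h⟫` in an eigenbasis of `A* A`, whose eigenvalues are the squared singular
values. -/
theorem norm_map_sq_eq_sum_singularValues (A : E →ₗ[ℂ] F) {n : ℕ}
    (hn : Module.finrank ℂ E = n) (h : E) :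
    ‖A h‖ ^ 2 = ∑ i : Fin n, A.singularValues i ^ 2 *
      ‖inner ℂ (A.isSymmetric_adjoint_comp_self.eigenvectorBasis hn i) h‖ ^ 2 := by
  set b := A.isSymmetric_adjoint_comp_self.eigenvectorBasis hn
  have h1 : inner ℂ h ((LinearMap.adjoint A ∘ₗ A) h) = ((‖A h‖ ^ 2 : ℝ) : ℂ) := by
    rw [LinearMap.comp_apply, LinearMap.adjoint_inner_right, inner_self_eq_norm_sq_to_K]
    norm_cast
  have h2 : ∀ i, inner ℂ (b i) ((LinearMap.adjoint A ∘ₗ A) h) =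
      ((A.singularValues i ^ 2 : ℝ) : ℂ) * inner ℂ (b i) h := fun i => by
    have := A.isSymmetric_adjoint_comp_self.eigenvectorBasis_apply_self_apply hn h i
    rw [OrthonormalBasis.repr_apply_apply, OrthonormalBasis.repr_apply_apply] at this
    rw [A.sq_singularValues_fin hn]
    exact this
  have h3 := b.sum_inner_mul_inner h ((LinearMap.adjoint A ∘ₗ A) h)
  rw [h1] at h3
  simp only [h2] at h3
  have h4 : ((‖A h‖ ^ 2 : ℝ) : ℂ) = ((∑ i : Fin n, A.singularValues i ^ 2 *
      ‖inner ℂ (b i) h‖ ^ 2 : ℝ) : ℂ) := by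
    rw [← h3, Complex.ofReal_sum]
    refine Finset.sum_congr rfl fun i _ => ?_
    rw [mul_left_comm, Complex.ofReal_mul, ← inner_conj_symm h (b i), ← Complex.normSq_eq_conj_mul_self,
      Complex.normSq_eq_norm_sq]
  exact_mod_cast h4

theorem norm_map_le_singularValues_zero (A : E →ₗ[ℂ] F) (h : E) :
    ‖A h‖ ≤ A.singularValues 0 * ‖h‖ := by
  refine abs_le_of_sq_le_sq' ?_ (mul_nonneg (A.singularValues_nonneg 0) (norm_nonneg _)) |>.2
  rw [norm_map_sq_eq_sum_singularValues A rfl, mul_pow,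
    ← (A.isSymmetric_adjoint_comp_self.eigenvectorBasis rfl).sum_sq_norm_inner_right h,
    Finset.mul_sum]
  gcongr with i
  · exact A.singularValues_nonneg _
  · exact A.singularValues_antitone (Nat.zero_le _)

theorem singularValues_last_mul_norm_le (A : E →ₗ[ℂ] F) (h : E) :
    A.singularValues (Module.finrank ℂ E - 1) * ‖h‖ ≤ ‖A h‖ := by
  refine abs_le_of_sq_le_sq' ?_ (norm_nonneg _) |>.2
  rw [norm_map_sq_eq_sum_singularValues A rfl, mul_pow,
    ← (A.isSymmetric_adjoint_comp_self.eigenvectorBasis rfl).sum_sq_norm_inner_right h,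
    Finset.mul_sum]
  gcongr with i
  · exact A.singularValues_nonneg _
  · exact A.singularValues_antitone (by omega)

end SingularValues

/-! ### The pseudoinverse, the optimal scaling and the incoherent frame of `T` -/

section Matrix

variable {N n : ℕ} {T : Matrix (Fin N) (Fin n) ℂ}

theorem norm_toEuclideanLin_le (T : Matrix (Fin N) (Fin n) ℂ) (h : EuclideanSpace ℂ (Fin n)) :
    ‖T.toEuclideanLin h‖ ≤ sigmaMax T * ‖h‖ :=
  norm_map_le_singularValues_zero _ h

theorem sigmaMax_nonneg (T : Matrix (Fin N) (Fin n) ℂ) : 0 ≤ sigmaMax T :=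
  LinearMap.singularValues_nonneg _ 0

theorem sigmaMin_mul_norm_le (T : Matrix (Fin N) (Fin n) ℂ) (h : EuclideanSpace ℂ (Fin n)) :
    sigmaMin T * ‖h‖ ≤ ‖T.toEuclideanLin h‖ := by
  simpa [sigmaMin] using singularValues_last_mul_norm_le T.toEuclideanLin h

theorem toEuclideanLin_injective (hT : Function.Injective T.mulVec) :
    Function.Injective T.toEuclideanLin := by
  intro x y hxy
  apply (WithLp.ofLp_injective 2)
  apply hT
  exact congrArg (WithLp.ofLp) hxy

theorem sigmaMin_pos (hn : 0 < n) (hT : Function.Injective T.mulVec) : 0 < sigmaMin T :=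
  (LinearMap.injective_iff_forall_lt_finrank_singularValues_pos _).mp
    (toEuclideanLin_injective hT) _ (by rw [finrank_euclideanSpace_fin]; omega)

theorem norm_adjoint_toEuclideanLin_le (T : Matrix (Fin N) (Fin n) ℂ)
    (y : EuclideanSpace ℂ (Fin N)) :
    ‖LinearMap.adjoint T.toEuclideanLin y‖ ≤ sigmaMax T * ‖y‖ := by
  set z := LinearMap.adjoint T.toEuclideanLin y with hz
  rcases eq_or_lt_of_le (norm_nonneg z) with h0 | h0
  · rw [← h0]; exact mul_nonneg (sigmaMax_nonneg T) (norm_nonneg _)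
  refine le_of_mul_le_mul_right ?_ h0
  calc ‖z‖ * ‖z‖ = ‖inner ℂ z z‖ := (norm_inner_self_eq z).symm
    _ = ‖inner ℂ y (T.toEuclideanLin z)‖ := by
        nth_rewrite 1 [hz]; rw [LinearMap.adjoint_inner_left]
    _ ≤ ‖y‖ * ‖T.toEuclideanLin z‖ := norm_inner_le_norm _ _
    _ ≤ ‖y‖ * (sigmaMax T * ‖z‖) := by gcongr; exact norm_toEuclideanLin_le T z
    _ = _ := by ring

theorem toEuclideanLin_mul_apply {l m n : ℕ} (A : Matrix (Fin l) (Fin m) ℂ)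
    (B : Matrix (Fin m) (Fin n) ℂ) (x : EuclideanSpace ℂ (Fin n)) :
    (A * B).toEuclideanLin x = A.toEuclideanLin (B.toEuclideanLin x) := by
  simp

theorem pinv_toEuclideanLin_apply (hT : Function.Injective T.mulVec)
    (h : EuclideanSpace ℂ (Fin n)) : (pinv T).toEuclideanLin (T.toEuclideanLin h) = h := by
  rw [← toEuclideanLin_mul_apply, pinv_mul_self hT]
  simp

theorem adjoint_adjoint_pinv_apply (hT : Function.Injective T.mulVec)
    (h : EuclideanSpace ℂ (Fin n)) :
    LinearMap.adjoint T.toEuclideanLin (LinearMap.adjoint (pinv T).toEuclideanLin h) = h := by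
  refine ext_inner_left ℂ fun z => ?_
  rw [LinearMap.adjoint_inner_right, LinearMap.adjoint_inner_right, pinv_toEuclideanLin_apply hT]

theorem adjoint_pinv_adjoint_toEuclideanLin (hT : Function.Injective T.mulVec)
    (h : EuclideanSpace ℂ (Fin n)) :
    LinearMap.adjoint (pinv T).toEuclideanLin (LinearMap.adjoint T.toEuclideanLin
      (T.toEuclideanLin h)) = T.toEuclideanLin h := by
  obtain ⟨h1, -, h3, -⟩ := (isMoorePenrose_iff hT _).mpr rfl
  rw [← Matrix.toEuclideanLin_conjTranspose_eq_adjoint,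
    ← Matrix.toEuclideanLin_conjTranspose_eq_adjoint, ← toEuclideanLin_mul_apply,
    ← toEuclideanLin_mul_apply, ← Matrix.conjTranspose_mul, h3, h1]

theorem norm_toEuclideanLin_single_le (T : Matrix (Fin N) (Fin n) ℂ) (k : Fin n) :
    ‖T.toEuclideanLin (EuclideanSpace.single k 1)‖ ≤ opNorm 1 2 T := by
  have := (Matrix.toLpLin 1 2 T).toContinuousLinearMap.le_opNorm (WithLp.toLp 1 (Pi.single k 1))
  have h1 : ‖(WithLp.toLp 1 (Pi.single k 1) : PiLp 1 fun _ : Fin n => ℂ)‖ = 1 := by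
    rw [PiLp.norm_eq_of_L1]
    simp [Pi.single_apply, apply_ite]
  rw [h1, mul_one] at this
  exact this

theorem norm_toEuclideanLin_apply_le_opNorm {B : Matrix (Fin n) (Fin N) ℂ} (y : EuclideanSpace ℂ (Fin N))
    (k : Fin n) : ‖B.toEuclideanLin y k‖ ≤ opNorm 2 ∞ B * ‖y‖ := by
  have h1 := (Matrix.toLpLin 2 ∞ B).toContinuousLinearMap.le_opNorm y
  exact (PiLp.norm_apply_le ((Matrix.toLpLin 2 ∞ B) y) k).trans h1

theorem opNorm_nonneg {p q : ℝ≥0∞} [Fact (1 ≤ p)] [Fact (1 ≤ q)]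
    (A : Matrix (Fin N) (Fin n) ℂ) : 0 ≤ opNorm p q A := norm_nonneg _

theorem norm_adjoint_single_le (B : Matrix (Fin n) (Fin N) ℂ) (k : Fin n) :
    ‖LinearMap.adjoint B.toEuclideanLin (EuclideanSpace.single k 1)‖ ≤ opNorm 2 ∞ B := by
  set z := LinearMap.adjoint B.toEuclideanLin (EuclideanSpace.single k 1) with hz
  rcases eq_or_lt_of_le (norm_nonneg z) with h0 | h0
  · rw [← h0]; exact opNorm_nonneg _
  refine le_of_mul_le_mul_right ?_ h0
  calc ‖z‖ * ‖z‖ = ‖inner ℂ z z‖ := (norm_inner_self_eq z).symm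
    _ = ‖B.toEuclideanLin z k‖ := by
        nth_rewrite 1 [hz]; rw [LinearMap.adjoint_inner_left, EuclideanSpace.inner_single_left]
        simp
    _ ≤ _ := norm_toEuclideanLin_apply_le_opNorm z k

theorem one_le_opNorm_mul_opNorm (hn : 0 < n) (hT : Function.Injective T.mulVec) :
    1 ≤ opNorm 1 2 T * opNorm 2 ∞ (pinv T) := by
  have h1 := norm_toEuclideanLin_apply_le_opNorm (B := pinv T)
    (T.toEuclideanLin (EuclideanSpace.single ⟨0, hn⟩ 1)) ⟨0, hn⟩
  rw [pinv_toEuclideanLin_apply hT] at h1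
  have h2 := norm_toEuclideanLin_single_le T ⟨0, hn⟩
  calc (1 : ℝ) ≤ _ := by simpa using h1
    _ ≤ opNorm 2 ∞ (pinv T) * opNorm 1 2 T := by
        gcongr; exact opNorm_nonneg _
    _ = _ := mul_comm _ _

/-- The analysis vectors `γ^(1/2) T e_k`. -/
noncomputable def analysisVec (T : Matrix (Fin N) (Fin n) ℂ) (γ : ℝ) (k : Fin n) :
    EuclideanSpace ℂ (Fin N) :=
  ((√γ : ℝ) : ℂ) • T.toEuclideanLin (EuclideanSpace.single k 1)

/-- The dual vectors `γ^(-1/2) (T†)* e_k`. -/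
noncomputable def dualVec (T : Matrix (Fin N) (Fin n) ℂ) (γ : ℝ) (k : Fin n) :
    EuclideanSpace ℂ (Fin N) :=
  (((√γ)⁻¹ : ℝ) : ℂ) • LinearMap.adjoint (pinv T).toEuclideanLin (EuclideanSpace.single k 1)

theorem inner_analysisVec (γ : ℝ) (k : Fin n) (q : EuclideanSpace ℂ (Fin N)) :
    inner ℂ (analysisVec T γ k) q = (√γ : ℝ) * LinearMap.adjoint T.toEuclideanLin q k := by
  rw [analysisVec, inner_smul_left, ← LinearMap.adjoint_inner_right,
    EuclideanSpace.inner_single_left, Complex.conj_ofReal]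
  simp

theorem frameOp_analysisVec_dualVec {γ : ℝ} (hγ : 0 < γ) (q : EuclideanSpace ℂ (Fin N)) :
    frameOp (analysisVec T γ) (dualVec T γ) q =
      LinearMap.adjoint (pinv T).toEuclideanLin (LinearMap.adjoint T.toEuclideanLin q) := by
  have h0 : ((√γ : ℝ) : ℂ) ≠ 0 := by exact_mod_cast (Real.sqrt_pos.mpr hγ).ne'
  set z := LinearMap.adjoint T.toEuclideanLin q with hz
  have h1 : z = ∑ k, z k • EuclideanSpace.single k (1 : ℂ) := by
    simpa using ((EuclideanSpace.basisFun (Fin n) ℂ).sum_repr z).symm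
  rw [h1, map_sum, frameOp]
  refine Finset.sum_congr rfl fun k _ => ?_
  rw [inner_analysisVec, dualVec, smul_smul, map_smul, ← hz]
  congr 1
  push_cast
  field_simp

theorem sum_norm_inner_analysisVec_sq (γ : ℝ) (hγ : 0 ≤ γ) (q : EuclideanSpace ℂ (Fin N)) :
    ∑ k, ‖inner ℂ (analysisVec T γ k) q‖ ^ 2 =
      γ * ‖LinearMap.adjoint T.toEuclideanLin q‖ ^ 2 := by
  rw [EuclideanSpace.norm_sq_eq, Finset.mul_sum]
  refine Finset.sum_congr rfl fun k _ => ?_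
  rw [inner_analysisVec, norm_mul, mul_pow, Complex.norm_real, Real.norm_of_nonneg (by positivity),
    Real.sq_sqrt hγ]

theorem toLpLin_smul_sub_one_apply (γ : ℝ) (x : EuclideanSpace ℂ (Fin n)) :
    Matrix.toLpLin 2 2 ((γ : ℂ) • (Tᴴ * T) - 1) x =
      (γ : ℂ) • LinearMap.adjoint T.toEuclideanLin (T.toEuclideanLin x) - x := by
  rw [← Matrix.toEuclideanLin_conjTranspose_eq_adjoint, ← toEuclideanLin_mul_apply,
    Matrix.toLpLin_apply, Matrix.sub_mulVec, Matrix.smul_mulVec, Matrix.one_mulVec]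
  rfl

theorem deviation_le_of_norm_le {γ c : ℝ} (hc : 0 ≤ c)
    (h : ∀ x, ‖(γ : ℂ) • LinearMap.adjoint T.toEuclideanLin (T.toEuclideanLin x) - x‖ ≤ c * ‖x‖) :
    deviation T γ ≤ c := by
  refine ContinuousLinearMap.opNorm_le_bound _ hc fun x => ?_
  have := h x
  rw [← toLpLin_smul_sub_one_apply] at this
  exact this

theorem norm_le_deviation_mul (γ : ℝ) (x : EuclideanSpace ℂ (Fin n)) :
    ‖(γ : ℂ) • LinearMap.adjoint T.toEuclideanLin (T.toEuclideanLin x) - x‖ ≤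
      deviation T γ * ‖x‖ := by
  rw [← toLpLin_smul_sub_one_apply]
  exact (Matrix.toLpLin 2 2 ((γ : ℂ) • (Tᴴ * T) - 1)).toContinuousLinearMap.le_opNorm x

theorem inner_adjoint_comp_self (x : EuclideanSpace ℂ (Fin n)) :
    inner ℂ (LinearMap.adjoint T.toEuclideanLin (T.toEuclideanLin x)) x =
      ((‖T.toEuclideanLin x‖ ^ 2 : ℝ) : ℂ) := by
  rw [LinearMap.adjoint_inner_left, inner_self_eq_norm_sq_to_K]
  norm_cast

/-- Comparison with the admissible scaling `1 / σ_max²`, whose deviation is at most `√(1 - σ_min² /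
σ_max²)`. -/
theorem deviation_lt_one (hn : 0 < n) (hT : Function.Injective T.mulVec) {γ : ℝ}
    (hγ : IsOptimalScaling T γ) : deviation T γ < 1 := by
  set σ := sigmaMax T
  have hσmin := sigmaMin_pos hn hT
  have hσ : 0 < σ := by
    have h1 := sigmaMin_mul_norm_le T (EuclideanSpace.single ⟨0, hn⟩ 1)
    have h2 := norm_toEuclideanLin_le T (EuclideanSpace.single ⟨0, hn⟩ 1)
    have h3 : ‖(EuclideanSpace.single ⟨0, hn⟩ 1 : EuclideanSpace ℂ (Fin n))‖ = 1 := by simp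
    rw [h3, mul_one] at h1 h2
    linarith
  set c : ℝ := 1 - (sigmaMin T) ^ 2 / σ ^ 2
  have hkey : ∀ x, ‖((1 / σ ^ 2 : ℝ) : ℂ) • LinearMap.adjoint T.toEuclideanLin
      (T.toEuclideanLin x) - x‖ ^ 2 ≤ c * ‖x‖ ^ 2 := fun x => by
    set w := T.toEuclideanLin x with hw
    have h1 : ‖LinearMap.adjoint T.toEuclideanLin w‖ ^ 2 ≤ σ ^ 2 * ‖w‖ ^ 2 := by
      rw [← mul_pow]; gcongr; exact norm_adjoint_toEuclideanLin_le T w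
    have h2 : (sigmaMin T) ^ 2 * ‖x‖ ^ 2 ≤ ‖w‖ ^ 2 := by
      rw [← mul_pow]; gcongr; exact sigmaMin_mul_norm_le T x
    rw [norm_sub_sq (𝕜 := ℂ), inner_smul_left, inner_adjoint_comp_self, norm_smul,
      Complex.norm_real, Real.norm_of_nonneg (by positivity), Complex.conj_ofReal,
      ← Complex.ofReal_mul]
    change _ - 2 * (1 / σ ^ 2 * ‖w‖ ^ 2) + _ ≤ _
    have h4 : (1 / σ ^ 2 * ‖LinearMap.adjoint T.toEuclideanLin w‖) ^ 2 ≤ 1 / σ ^ 2 * ‖w‖ ^ 2 := by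
      rw [mul_pow]
      calc (1 / σ ^ 2) ^ 2 * ‖LinearMap.adjoint T.toEuclideanLin w‖ ^ 2
          ≤ (1 / σ ^ 2) ^ 2 * (σ ^ 2 * ‖w‖ ^ 2) := by gcongr
        _ = _ := by field_simp
    have h5 : (sigmaMin T) ^ 2 / σ ^ 2 * ‖x‖ ^ 2 ≤ 1 / σ ^ 2 * ‖w‖ ^ 2 := by
      rw [div_mul_eq_mul_div, one_div_mul_eq_div]; gcongr
    have h6 : c * ‖x‖ ^ 2 = ‖x‖ ^ 2 - (sigmaMin T) ^ 2 / σ ^ 2 * ‖x‖ ^ 2 := by ring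
    linarith
  have hc1 : c < 1 := by
    have : 0 < (sigmaMin T) ^ 2 / σ ^ 2 := by positivity
    linarith
  have hdev : deviation T (1 / σ ^ 2) ≤ √c := by
    refine deviation_le_of_norm_le (Real.sqrt_nonneg _) fun x => ?_
    calc _ ≤ √(c * ‖x‖ ^ 2) := Real.le_sqrt_of_sq_le (hkey x)
      _ = _ := by rw [Real.sqrt_mul' _ (by positivity), Real.sqrt_sq (norm_nonneg _)]
  calc deviation T γ ≤ deviation T (1 / σ ^ 2) := hγ.2 _ (by positivity)
    _ ≤ √c := hdev
    _ < 1 := by rw [Real.sqrt_lt' one_pos]; simpa using hc1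

/-- The left side is `γ ‖T* q‖²`. Deviation at most 1 gives `γ T* T ≤ 2`, and this passes to `γ T
T*` through `‖T* q‖² = ⟪q, T T* q⟫`. -/
theorem sum_norm_inner_analysisVec_sq_le {γ : ℝ} (hγ : 0 < γ) (hdev : deviation T γ ≤ 1)
    (q : EuclideanSpace ℂ (Fin N)) :
    ∑ k, ‖inner ℂ (analysisVec T γ k) q‖ ^ 2 ≤ 2 * ‖q‖ ^ 2 := by
  rw [sum_norm_inner_analysisVec_sq γ hγ.le]
  set z := LinearMap.adjoint T.toEuclideanLin q with hz
  have h1 : γ * ‖T.toEuclideanLin z‖ ^ 2 ≤ 2 * ‖z‖ ^ 2 := by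
    set g := LinearMap.adjoint T.toEuclideanLin (T.toEuclideanLin z) with hg
    have h2 : ‖(γ : ℂ) • g‖ ≤ 2 * ‖z‖ := by
      calc ‖(γ : ℂ) • g‖ = ‖((γ : ℂ) • g - z) + z‖ := by rw [sub_add_cancel]
        _ ≤ ‖(γ : ℂ) • g - z‖ + ‖z‖ := norm_add_le _ _
        _ ≤ 1 * ‖z‖ + ‖z‖ := by
            gcongr; exact (norm_le_deviation_mul γ z).trans (by gcongr)
        _ = _ := by ring
    calc γ * ‖T.toEuclideanLin z‖ ^ 2 = ‖inner ℂ ((γ : ℂ) • g) z‖ := by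
          rw [inner_smul_left, inner_adjoint_comp_self, Complex.conj_ofReal,
            ← Complex.ofReal_mul, Complex.norm_real, Real.norm_of_nonneg (by positivity)]
      _ ≤ ‖(γ : ℂ) • g‖ * ‖z‖ := norm_inner_le_norm _ _
      _ ≤ 2 * ‖z‖ * ‖z‖ := by gcongr
      _ = _ := by ring
  have h3 : ‖z‖ ^ 2 ≤ ‖q‖ * ‖T.toEuclideanLin z‖ := by
    calc ‖z‖ ^ 2 = ‖inner ℂ z z‖ := by rw [norm_inner_self_eq, sq]
      _ = ‖inner ℂ q (T.toEuclideanLin z)‖ := by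
          nth_rewrite 1 [hz]; rw [LinearMap.adjoint_inner_left]
      _ ≤ _ := norm_inner_le_norm _ _
  rcases eq_or_lt_of_le (norm_nonneg z) with h0 | h0
  · rw [← h0]; simp
  refine le_of_mul_le_mul_right ?_ (by positivity : 0 < ‖z‖ ^ 2)
  calc γ * ‖z‖ ^ 2 * ‖z‖ ^ 2 = γ * (‖z‖ ^ 2) ^ 2 := by ring
    _ ≤ γ * (‖q‖ * ‖T.toEuclideanLin z‖) ^ 2 := by gcongr
    _ = ‖q‖ ^ 2 * (γ * ‖T.toEuclideanLin z‖ ^ 2) := by ring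
    _ ≤ ‖q‖ ^ 2 * (2 * ‖z‖ ^ 2) := by gcongr
    _ = _ := by ring

theorem norm_le_vecNorm_top {m : ℕ} (f : Fin m → ℂ) (a : Fin m) : ‖f a‖ ≤ vecNorm ∞ f :=
  PiLp.norm_apply_le (WithLp.toLp ∞ f) a

theorem isIncoherent_analysisVec_dualVec {γ : ℝ} (hγ : 0 < γ) (hdev : deviation T γ ≤ 1) :
    IsIncoherent (analysisVec T γ) (dualVec T γ) (incoherence T γ) := by
  have hbdd := Set.Finite.bddAbove (Set.finite_range fun k : Fin n => max
    ((n : ℝ) * vecNorm ∞ (((√γ : ℝ) : ℂ) • (T *ᵥ Pi.single k 1)) ^ 2)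
    ((n : ℝ) * vecNorm ∞ ((((√γ)⁻¹ : ℝ) : ℂ) • ((pinv T)ᴴ *ᵥ Pi.single k 1)) ^ 2))
  refine ⟨fun k a => ?_, fun k a => ?_, sum_norm_inner_analysisVec_sq_le hγ hdev⟩
  · refine le_trans ?_ ((le_max_left _ _).trans (le_ciSup hbdd k))
    rw [Fintype.card_fin]
    gcongr
    exact norm_le_vecNorm_top (((√γ : ℝ) : ℂ) • (T *ᵥ Pi.single k 1)) a
  · refine le_trans ?_ ((le_max_right _ _).trans (le_ciSup hbdd k))
    rw [Fintype.card_fin]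
    gcongr
    rw [dualVec, ← Matrix.toEuclideanLin_conjTranspose_eq_adjoint]
    exact norm_le_vecNorm_top ((((√γ)⁻¹ : ℝ) : ℂ) • ((pinv T)ᴴ *ᵥ Pi.single k 1)) a

end Matrix

/-- Read the reproducing identity `P w = w` at an entry where `|w|` is largest: the kernel entries
`∑ k, |u k c| |v k a|` are at most `μ`, and only the `|J|` columns in the support contribute. This
lets `M = 1 + 2 μ |J|` be replaced by `3 μ |J|`. -/
theorem IsIncoherent.one_le_mul_card {ι α : Type*} [Fintype ι] [Fintype α] [DecidableEq α]
    [Nonempty ι] {u v : ι → EuclideanSpace ℂ α} {μ : ℝ} (h : IsIncoherent u v μ) {J : Finset α}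
    {w : EuclideanSpace ℂ α} (hw : w ≠ 0) (hJ : ∀ a ∉ J, w a = 0) (hP : frameOp u v w = w) :
    1 ≤ μ * J.card := by
  obtain ⟨b, hb⟩ : ∃ b, w b ≠ 0 := by
    by_contra! H
    exact hw (by ext b; simpa using H b)
  have : Nonempty α := ⟨b⟩
  obtain ⟨a, -, ha⟩ := Finset.exists_max_image Finset.univ (fun a => ‖w a‖) ⟨b, Finset.mem_univ b⟩
  have hn : (0 : ℝ) < Fintype.card ι := by exact_mod_cast Fintype.card_pos
  have hwa : 0 < ‖w a‖ := (norm_pos_iff.mpr hb).trans_le (ha b (Finset.mem_univ b))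
  have huv : ∀ k c, Fintype.card ι * (‖u k c‖ * ‖v k a‖) ≤ μ := fun k c => by
    have h1 := h.left k c
    have h2 := h.right k a
    nlinarith [sq_nonneg (‖u k c‖ - ‖v k a‖)]
  have hin : ∀ k, ‖inner ℂ (u k) w * v k a‖ ≤ ∑ c ∈ J, ‖u k c‖ * ‖v k a‖ * ‖w a‖ := fun k => by
    have h1 : inner ℂ (u k) w = ∑ c ∈ J, inner ℂ (u k c) (w c) := by
      rw [PiLp.inner_apply]
      exact (Finset.sum_subset (Finset.subset_univ J) fun c _ hc => by simp [hJ c hc]).symm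
    rw [norm_mul, h1]
    calc ‖∑ c ∈ J, inner ℂ (u k c) (w c)‖ * ‖v k a‖
        ≤ (∑ c ∈ J, ‖u k c‖ * ‖w a‖) * ‖v k a‖ := by
          gcongr
          exact norm_sum_le_of_le _ fun c _ => (norm_inner_le_norm _ _).trans
            (by gcongr; exact ha c (Finset.mem_univ c))
      _ = _ := by rw [Finset.sum_mul]; exact Finset.sum_congr rfl fun c _ => by ring
  refine le_of_mul_le_mul_right ?_ (mul_pos hn hwa)
  calc 1 * (Fintype.card ι * ‖w a‖) = Fintype.card ι * ‖∑ k, inner ℂ (u k) w * v k a‖ := by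
        rw [one_mul]
        nth_rewrite 1 [← hP]
        simp [frameOp]
    _ ≤ Fintype.card ι * ∑ k, ∑ c ∈ J, ‖u k c‖ * ‖v k a‖ * ‖w a‖ := by
        gcongr
        exact norm_sum_le_of_le _ fun k _ => hin k
    _ = ∑ k, ∑ c ∈ J, Fintype.card ι * (‖u k c‖ * ‖v k a‖) * ‖w a‖ := by
        simp only [Finset.mul_sum]
        exact Finset.sum_congr rfl fun k _ => Finset.sum_congr rfl fun c _ => by ring
    _ ≤ ∑ _k : ι, ∑ _c ∈ J, μ * ‖w a‖ := by
        gcongr with k _ c _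
        exact huv k c
    _ = _ := by simp only [Finset.sum_const, Finset.card_univ, nsmul_eq_mul]; ring

/-! ### Sign vectors, the cone condition and what certificates imply -/

section Deterministic

variable {ι α : Type*} [Fintype ι] [Fintype α] [DecidableEq α]

/-- The entrywise complex sign. -/
noncomputable def signVec (t : EuclideanSpace ℂ α) : EuclideanSpace ℂ α :=
  WithLp.toLp 2 fun a => t a / ‖t a‖

theorem norm_signVec_apply_le (t : EuclideanSpace ℂ α) (a : α) : ‖signVec t a‖ ≤ 1 := by
  simp only [signVec, norm_div, Complex.norm_real, norm_norm]
  exact div_self_le_one _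

theorem restrict_signVec {t : EuclideanSpace ℂ α} {J : Finset α} (hJ : ∀ a ∉ J, t a = 0) :
    restrict J (signVec t) = signVec t := by
  ext a
  by_cases h : a ∈ J
  · simp [restrict_apply, h]
  · simp [restrict_apply, h, signVec, hJ a h]

/-- The sign vector is a subgradient of the ℓ₁ norm at `t`: on `J` the norm grows by at least `Re
⟪sign t, w⟫`, off `J` by exactly the mass of `w`. -/
theorem sum_norm_compl_le_norm_inner_signVec {t w : EuclideanSpace ℂ α} {J : Finset α}
    (hJ : ∀ a ∉ J, t a = 0) (hle : ∑ a, ‖t a + w a‖ ≤ ∑ a, ‖t a‖) :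
    ∑ a ∈ Jᶜ, ‖w a‖ ≤ ‖inner ℂ (signVec t) w‖ := by
  have hs : inner ℂ (signVec t) w = ∑ a ∈ J, inner ℂ (signVec t a) (w a) := by
    rw [PiLp.inner_apply]
    exact (Finset.sum_subset (Finset.subset_univ J) fun a _ ha => by
      simp [signVec, hJ a ha]).symm
  have h1 : ∀ a ∈ J, ‖t a‖ + (inner ℂ (signVec t a) (w a)).re ≤ ‖t a + w a‖ := fun a _ => by
    rcases eq_or_ne (t a) 0 with h0 | h0
    · simp [signVec, h0]
    have hn : (‖t a‖ : ℂ) ≠ 0 := by exact_mod_cast norm_ne_zero_iff.mpr h0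
    have h2 : inner ℂ (signVec t a) (t a) = (‖t a‖ : ℂ) := by
      rw [RCLike.inner_apply, signVec]
      simp only [map_div₀, Complex.conj_ofReal]
      rw [mul_div_assoc', Complex.mul_conj, Complex.normSq_eq_norm_sq]
      field_simp
      push_cast
      ring
    calc ‖t a‖ + (inner ℂ (signVec t a) (w a)).re = (inner ℂ (signVec t a) (t a + w a)).re := by
          rw [inner_add_right, h2, Complex.add_re, Complex.ofReal_re]
      _ ≤ ‖inner ℂ (signVec t a) (t a + w a)‖ := Complex.re_le_norm _
      _ ≤ ‖signVec t a‖ * ‖t a + w a‖ := norm_inner_le_norm _ _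
      _ ≤ 1 * ‖t a + w a‖ := by gcongr; exact norm_signVec_apply_le t a
      _ = _ := one_mul _
  have h3 : ∑ a ∈ Jᶜ, ‖t a‖ = 0 := Finset.sum_eq_zero fun a ha => by
    rw [hJ a (Finset.mem_compl.mp ha), norm_zero]
  have h4 : ∑ a ∈ Jᶜ, ‖t a + w a‖ = ∑ a ∈ Jᶜ, ‖w a‖ := Finset.sum_congr rfl fun a ha => by
    rw [hJ a (Finset.mem_compl.mp ha), zero_add]
  rw [← Finset.sum_add_sum_compl J, ← Finset.sum_add_sum_compl J fun a => ‖t a‖, h3, h4] at hle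
  have h5 := Finset.sum_le_sum h1
  rw [Finset.sum_add_distrib, ← Complex.re_sum, ← hs] at h5
  have h6 := (abs_le.mp (Complex.abs_re_le_norm (inner ℂ (signVec t) w))).1
  linarith

theorem norm_le_sqrt_card {q : EuclideanSpace ℂ α} (hq : ∀ a, ‖q a‖ ≤ 1) :
    ‖q‖ ≤ √(Fintype.card α) := by
  rw [EuclideanSpace.norm_eq]
  gcongr
  calc ∑ a, ‖q a‖ ^ 2 ≤ ∑ _a : α, (1 : ℝ) := by
        gcongr with a; exact pow_le_one₀ (norm_nonneg _) (hq a)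
    _ = _ := by simp

theorem norm_le_sqrt_card_of_restrict {q : EuclideanSpace ℂ α} {J : Finset α}
    (hJ : restrict J q = q) (hq : ∀ a, ‖q a‖ ≤ 1) : ‖q‖ ≤ √J.card := by
  refine Real.le_sqrt_of_sq_le ?_
  rw [← hJ, norm_restrict_sq]
  calc ∑ a ∈ J, ‖q a‖ ^ 2 ≤ ∑ _a ∈ J, (1 : ℝ) := by
        gcongr with a; exact pow_le_one₀ (norm_nonneg _) (hq a)
    _ = _ := by simp

theorem norm_inner_sub_restrict_le {y w : EuclideanSpace ℂ α} {J : Finset α} {c : ℝ}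
    (hy : ∀ a ∉ J, ‖y a‖ ≤ c) : ‖inner ℂ (y - restrict J y) w‖ ≤ c * ∑ a ∈ Jᶜ, ‖w a‖ := by
  have : inner ℂ (y - restrict J y) w = ∑ a ∈ Jᶜ, inner ℂ (y a) (w a) := by
    rw [PiLp.inner_apply, ← Finset.sum_add_sum_compl J, Finset.sum_eq_zero, zero_add]
    · exact Finset.sum_congr rfl fun a ha => by
        simp [restrict_apply, Finset.mem_compl.mp ha]
    · intro a ha; simp [restrict_apply, ha]
  rw [this, Finset.mul_sum]
  exact norm_sum_le_of_le _ fun a ha => (norm_inner_le_norm _ _).trans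
    (by gcongr; exact hy a (Finset.mem_compl.mp ha))

namespace IsCertificate

variable {L : ι → EuclideanSpace ℂ α →ₗ[ℂ] ℂ} {J : Finset α} {q₀ y : EuclideanSpace ℂ α} {τ : ℝ}
  {A : Set ι}

theorem norm_le (h : IsCertificate L J q₀ τ A y) (hq : restrict J q₀ = q₀)
    (hq1 : ∀ a, ‖q₀ a‖ ≤ 1) : ‖y‖ ≤ √(Fintype.card α) + τ := by
  have h1 : ‖q₀ + (y - restrict J y)‖ ≤ √(Fintype.card α) := by
    refine norm_le_sqrt_card fun a => ?_
    by_cases ha : a ∈ J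
    · simpa [restrict_apply, ha] using hq1 a
    · have h0 : q₀ a = 0 := by rw [← hq, restrict_apply, if_neg ha]
      have := h.off_support a ha
      simp only [PiLp.add_apply, h0, PiLp.sub_apply, restrict_apply, ha, if_false, sub_zero,
        zero_add]
      linarith
  calc ‖y‖ = ‖(q₀ + (y - restrict J y)) + (restrict J y - q₀)‖ := by congr 1; abel
    _ ≤ _ := norm_add_le _ _
    _ ≤ _ := add_le_add h1 h.on_support

/-- Split `q₀` into `y`, minus its error on `J`, minus its part off `J`. -/
theorem norm_inner_le (h : IsCertificate L J q₀ τ A y) (w : EuclideanSpace ℂ α) :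
    ‖inner ℂ q₀ w‖ ≤ ‖inner ℂ y w‖ + τ * ‖w‖ + 1 / 2 * ∑ a ∈ Jᶜ, ‖w a‖ := by
  have h1 : inner ℂ q₀ w =
      inner ℂ y w - inner ℂ (restrict J y - q₀) w - inner ℂ (y - restrict J y) w := by
    rw [← inner_sub_left, ← inner_sub_left]; congr 1; abel
  rw [h1]
  calc _ ≤ ‖inner ℂ y w‖ + ‖inner ℂ (restrict J y - q₀) w‖ + ‖inner ℂ (y - restrict J y) w‖ :=
        (norm_sub_le _ _).trans (by gcongr; exact norm_sub_le _ _)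
    _ ≤ _ := by
        gcongr
        · exact (norm_inner_le_norm _ _).trans (by gcongr; exact h.on_support)
        · exact norm_inner_sub_restrict_le h.off_support

end IsCertificate

end Deterministic

/-! ### Stable recovery from certificates -/

section Recovery

variable {N n : ℕ} {T : Matrix (Fin N) (Fin n) ℂ}

/-- The entries of `T* y`, as functionals of `y`. -/
noncomputable def adjointEntry (T : Matrix (Fin N) (Fin n) ℂ) (k : Fin n) :
    EuclideanSpace ℂ (Fin N) →ₗ[ℂ] ℂ :=
  (EuclideanSpace.proj k : EuclideanSpace ℂ (Fin n) →L[ℂ] ℂ).toLinearMap ∘ₗ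
    LinearMap.adjoint T.toEuclideanLin

theorem adjointEntry_apply (k : Fin n) (y : EuclideanSpace ℂ (Fin N)) :
    adjointEntry T k y = LinearMap.adjoint T.toEuclideanLin y k := rfl

theorem adjointEntry_dualVec (hT : Function.Injective T.mulVec) (γ : ℝ) (k l : Fin n)
    (hkl : k ≠ l) : adjointEntry T k (dualVec T γ l) = 0 := by
  rw [dualVec, map_smul, adjointEntry_apply, adjoint_adjoint_pinv_apply hT]
  simp [hkl]

theorem adjointEntry_frameOp (hT : Function.Injective T.mulVec) {γ : ℝ} (hγ : 0 < γ) (k : Fin n)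
    (q : EuclideanSpace ℂ (Fin N)) :
    adjointEntry T k (frameOp (analysisVec T γ) (dualVec T γ) q) = adjointEntry T k q := by
  rw [frameOp_analysisVec_dualVec hγ, adjointEntry_apply, adjoint_adjoint_pinv_apply hT,
    adjointEntry_apply]

/-- Moving `T` across the inner product leaves `T* y`, which is supported on the sampled set. -/
theorem norm_inner_map_le {Λ : Finset (Fin n)} {y : EuclideanSpace ℂ (Fin N)}
    (hy : ∀ k ∉ Λ, adjointEntry T k y = 0) (h : EuclideanSpace ℂ (Fin n)) :
    ‖inner ℂ y (T.toEuclideanLin h)‖ ≤ sigmaMax T * ‖y‖ * ‖restrict Λ h‖ := by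
  have h1 : restrict Λ (LinearMap.adjoint T.toEuclideanLin y) =
      LinearMap.adjoint T.toEuclideanLin y := by
    ext k
    by_cases hk : k ∈ Λ
    · simp [restrict_apply, hk]
    · rw [restrict_apply, if_neg hk]; exact (hy k hk).symm
  rw [← LinearMap.adjoint_inner_left, ← h1, inner_restrict_left]
  exact (norm_inner_le_norm _ _).trans
    (mul_le_mul_of_nonneg_right (norm_adjoint_toEuclideanLin_le T y) (norm_nonneg _))

/-- The normalized rows of the pseudoinverse, restricted to `J`. -/
noncomputable def rowTarget (T : Matrix (Fin N) (Fin n) ℂ) (J : Finset (Fin N)) (k : Fin n) :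
    EuclideanSpace ℂ (Fin N) :=
  restrict J (((opNorm 2 ∞ (pinv T))⁻¹ : ℂ) •
    LinearMap.adjoint (pinv T).toEuclideanLin (EuclideanSpace.single k 1))

theorem norm_normalized_row_apply_le (k : Fin n) (a : Fin N) :
    ‖(((opNorm 2 ∞ (pinv T))⁻¹ : ℂ) •
      LinearMap.adjoint (pinv T).toEuclideanLin (EuclideanSpace.single k 1)) a‖ ≤ 1 := by
  refine (PiLp.norm_apply_le _ a).trans ?_
  rw [norm_smul, norm_inv, Complex.norm_real, Real.norm_of_nonneg (opNorm_nonneg _)]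
  exact (mul_le_mul_of_nonneg_left (norm_adjoint_single_le _ k)
    (inv_nonneg.mpr (opNorm_nonneg _))).trans inv_mul_le_one

theorem norm_rowTarget_apply_le (J : Finset (Fin N)) (k : Fin n) (a : Fin N) :
    ‖rowTarget T J k a‖ ≤ 1 := by
  rw [rowTarget, restrict_apply]
  split_ifs
  · exact norm_normalized_row_apply_le k a
  · simp

theorem norm_map_le_of_certificates (hn : 0 < n) (hT : Function.Injective T.mulVec)
    {Λ : Finset (Fin n)} {J : Finset (Fin N)} {t : EuclideanSpace ℂ (Fin N)}
    (hJ : ∀ a ∉ J, t a = 0) {h : EuclideanSpace ℂ (Fin n)} {τ δ : ℝ}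
    (hτ : τ = 1 / (8 * n * (opNorm 1 2 T * opNorm 2 ∞ (pinv T))))
    (hδ : ‖restrict Λ h‖ ≤ δ)
    (hcone : ∑ a ∈ Jᶜ, ‖T.toEuclideanLin h a‖ ≤ ‖inner ℂ (signVec t) (T.toEuclideanLin h)‖)
    (hsign : ∃ y, IsCertificate (adjointEntry T) J (signVec t) τ (Λ : Set (Fin n)) y)
    (hrow : ∀ k, ∃ y, IsCertificate (adjointEntry T) J (rowTarget T J k) τ (Λ : Set (Fin n)) y) :
    ‖T.toEuclideanLin h‖ ≤
      8 * n * (opNorm 1 2 T * opNorm 2 ∞ (pinv T)) * (sigmaMax T * (√N + τ) * δ) := by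
  set κ := opNorm 2 ∞ (pinv T) with hκ
  set K := opNorm 1 2 T * κ with hKdef
  have hK : 1 ≤ K := one_le_opNorm_mul_opNorm hn hT
  have hκ0 : 0 ≤ κ := opNorm_nonneg _
  have hκ1 : 0 < κ := lt_of_le_of_ne hκ0 fun h0 => by rw [hKdef, ← h0, mul_zero] at hK; linarith
  have hn1 : (1 : ℝ) ≤ n := by exact_mod_cast hn
  have hnK : 1 ≤ n * K := by nlinarith
  set w := T.toEuclideanLin h with hw
  set b := ∑ a ∈ Jᶜ, ‖w a‖
  set D := sigmaMax T * (√N + τ) * δ with hD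
  have hδ0 : 0 ≤ δ := (norm_nonneg _).trans hδ
  have hσ := sigmaMax_nonneg T
  have hτ0 : 0 < τ := by rw [hτ]; positivity
  have hD0 : 0 ≤ D := by positivity
  have hcert : ∀ q₀, restrict J q₀ = q₀ → (∀ a, ‖q₀ a‖ ≤ 1) →
      (∃ y, IsCertificate (adjointEntry T) J q₀ τ (Λ : Set (Fin n)) y) →
      ‖inner ℂ q₀ w‖ ≤ D + τ * ‖w‖ + 1 / 2 * b := by
    rintro q₀ hq hq1 ⟨y, hy⟩
    refine (hy.norm_inner_le w).trans ?_
    gcongr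
    have hyn := hy.norm_le hq hq1
    rw [Fintype.card_fin] at hyn
    refine (norm_inner_map_le (fun k hk => hy.eq_zero k (by simpa using hk)) h).trans ?_
    rw [hD]
    gcongr
  -- The cone condition gives `b ≤ D + τ ‖w‖ + b / 2`; the off-support bound 1/2 leaves room to
  -- absorb `b`.
  have hb : b ≤ 2 * D + 2 * (τ * ‖w‖) := by
    have := hcert _ (restrict_signVec hJ) (norm_signVec_apply_le t) hsign
    linarith
  have hk : ∀ k, ‖h k‖ ≤ κ * (4 * D + 4 * (τ * ‖w‖)) := by
    intro k
    set z : EuclideanSpace ℂ (Fin N) :=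
      LinearMap.adjoint (pinv T).toEuclideanLin (EuclideanSpace.single k 1) with hz
    have h1 : inner ℂ z w = h k := by
      rw [hz, LinearMap.adjoint_inner_left, hw, pinv_toEuclideanLin_apply hT,
        EuclideanSpace.inner_single_left]
      simp
    have h2 : ‖inner ℂ (((κ)⁻¹ : ℂ) • z) w‖ ≤ (D + τ * ‖w‖ + 1 / 2 * b) + 1 * b := by
      have hr := hcert _ (restrict_restrict J _) (norm_rowTarget_apply_le J k) (hrow k)
      -- Only the part of the row on `J` has a certificate. The rest has entries at most 1 after
      -- normalization and costs one more `b`.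
      have hoff := norm_inner_sub_restrict_le (y := ((κ)⁻¹ : ℂ) • z) (w := w) (J := J) (c := 1)
        fun a _ => norm_normalized_row_apply_le k a
      calc ‖inner ℂ (((κ)⁻¹ : ℂ) • z) w‖
          = ‖inner ℂ (rowTarget T J k) w +
              inner ℂ (((κ)⁻¹ : ℂ) • z - restrict J (((κ)⁻¹ : ℂ) • z)) w‖ := by
            rw [← inner_add_left]; congr 2; rw [rowTarget]; abel
        _ ≤ _ := norm_add_le _ _
        _ ≤ _ := add_le_add hr hoff
    have h3 : ‖inner ℂ (((κ)⁻¹ : ℂ) • z) w‖ = κ⁻¹ * ‖h k‖ := by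
      rw [inner_smul_left, h1, norm_mul, RCLike.norm_conj, norm_inv, Complex.norm_real,
        Real.norm_of_nonneg hκ0]
    rw [h3, inv_mul_le_iff₀ hκ1] at h2
    exact h2.trans (mul_le_mul_of_nonneg_left (by linarith) hκ0)
  have hwsum : ‖w‖ ≤ n * K * (4 * D + 4 * (τ * ‖w‖)) := by
    have h1 : h = ∑ k, h k • EuclideanSpace.single k (1 : ℂ) := by
      simpa using ((EuclideanSpace.basisFun (Fin n) ℂ).sum_repr h).symm
    have h2 : w = ∑ k, h k • T.toEuclideanLin (EuclideanSpace.single k 1) := by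
      rw [hw]; nth_rewrite 1 [h1]; simp only [map_sum, map_smul]
    calc ‖w‖ = ‖∑ k, h k • T.toEuclideanLin (EuclideanSpace.single k 1)‖ := by rw [← h2]
      _ ≤ ∑ _k : Fin n, κ * (4 * D + 4 * (τ * ‖w‖)) * opNorm 1 2 T :=
          norm_sum_le_of_le _ fun k _ => by
            rw [norm_smul]
            exact mul_le_mul (hk k) (norm_toEuclideanLin_single_le T k) (norm_nonneg _)
              (by positivity)
      _ = _ := by
          rw [Finset.sum_const, Finset.card_univ, Fintype.card_fin, nsmul_eq_mul, hKdef]; ring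
  -- This fixes `τ`: summing `n` entries multiplies the error by `4 n K τ`, which must stay below 1.
  have hτK : n * K * (4 * (τ * ‖w‖)) = 1 / 2 * ‖w‖ := by
    rw [hτ]; field_simp; ring
  rw [mul_add, hτK] at hwsum
  linarith

theorem norm_restrict_eq_vecNorm_sample (Λ : Finset (Fin n)) (g : Fin n → ℂ) :
    ‖restrict Λ (WithLp.toLp 2 g)‖ = vecNorm 2 (sample Λ g) := by
  rw [← Real.sqrt_sq (norm_nonneg (restrict Λ (WithLp.toLp 2 g))), norm_restrict_sq, vecNorm,
    EuclideanSpace.norm_eq]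
  congr 1
  exact (Finset.sum_coe_sort Λ fun k => ‖g k‖ ^ 2).symm

theorem vecNorm_one (f : Fin N → ℂ) : vecNorm 1 f = ∑ a, ‖f a‖ :=
  PiLp.norm_eq_of_L1 _

theorem vecNorm_nonneg {p : ℝ≥0∞} [Fact (1 ≤ p)] {ι : Type*} [Fintype ι] (f : ι → ℂ) :
    0 ≤ vecNorm p f := norm_nonneg _

theorem vecNorm_sample_sub_le {Λ : Finset (Fin n)} {x xs xhat : Fin n → ℂ} {ε : ℝ}
    (h1 : vecNorm 2 (sample Λ (x - xs)) ≤ ε)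
    (h2 : vecNorm 2 (sample Λ xhat - sample Λ xs) ≤ ε) :
    vecNorm 2 (sample Λ (xhat - x)) ≤ 2 * ε := by
  have e : WithLp.toLp 2 (sample Λ (xhat - x)) =
      WithLp.toLp 2 (sample Λ xhat - sample Λ xs) - WithLp.toLp 2 (sample Λ (x - xs)) := by
    ext k; simp [sample]
  rw [vecNorm, e]
  exact (norm_sub_le _ _).trans (by rw [two_mul]; exact add_le_add h2 h1)

theorem isMinimizer_vecNorm_le {Λ : Finset (Fin n)} {x xs xhat : Fin n → ℂ} {ε : ℝ}
    (h1 : vecNorm 2 (sample Λ (x - xs)) ≤ ε) (h2 : IsMinimizer T Λ xs ε xhat) :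
    vecNorm 1 (T *ᵥ xhat) ≤ vecNorm 1 (T *ᵥ x) :=
  h2.2 x h1

/-- The error bound, on the event that all the required certificates exist. -/
theorem vecNorm_sub_le_of_certificates (hn : 4 ≤ n) (hnN : n ≤ N)
    (hT : Function.Injective T.mulVec)
    {Λ : Finset (Fin n)} {J : Finset (Fin N)} {x xs xhat : Fin n → ℂ}
    (hJ : ∀ a ∉ J, (T *ᵥ x) a = 0) {τ ε : ℝ}
    (hτ : τ = 1 / (8 * n * (opNorm 1 2 T * opNorm 2 ∞ (pinv T))))
    (hsign : ∃ y, IsCertificate (adjointEntry T) J (signVec (WithLp.toLp 2 (T *ᵥ x))) τ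
      (Λ : Set (Fin n)) y)
    (hrow : ∀ k, ∃ y, IsCertificate (adjointEntry T) J (rowTarget T J k) τ (Λ : Set (Fin n)) y)
    (h1 : vecNorm 2 (sample Λ (x - xs)) ≤ ε) (h2 : IsMinimizer T Λ xs ε xhat) :
    vecNorm 2 (xhat - x) ≤ sigmaMax T / sigmaMin T *
      (2 + 28 * √(N : ℝ) * (3 * (n : ℝ) * opNorm 1 2 T * opNorm 2 ∞ (pinv T) + 1)) * ε := by
  have hn0 : 0 < n := by omega
  set h : EuclideanSpace ℂ (Fin n) := WithLp.toLp 2 (xhat - x) with hh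
  set K := opNorm 1 2 T * opNorm 2 ∞ (pinv T) with hKdef
  have hK : 1 ≤ K := one_le_opNorm_mul_opNorm hn0 hT
  have hε : 0 ≤ ε := (vecNorm_nonneg _).trans h1
  have hσ := sigmaMax_nonneg T
  have hσmin := sigmaMin_pos hn0 hT
  have hsum : ∀ a, (T *ᵥ xhat) a = (T *ᵥ x) a + T.toEuclideanLin h a := fun a => by
    rw [hh]
    simp [Matrix.toLpLin_apply, Matrix.mulVec_sub]
  have hcone : ∑ a ∈ Jᶜ, ‖T.toEuclideanLin h a‖ ≤
      ‖inner ℂ (signVec (WithLp.toLp 2 (T *ᵥ x))) (T.toEuclideanLin h)‖ := by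
    refine sum_norm_compl_le_norm_inner_signVec hJ ?_
    have := isMinimizer_vecNorm_le h1 h2
    simpa only [vecNorm_one, hsum] using this
  have hδ : ‖restrict Λ h‖ ≤ 2 * ε := by
    rw [hh, norm_restrict_eq_vecNorm_sample]
    exact vecNorm_sample_sub_le h1 h2.1
  have hw := norm_map_le_of_certificates (t := WithLp.toLp 2 (T *ᵥ x)) hn0 hT hJ hτ hδ hcone
    hsign hrow
  have hN : (1 : ℝ) ≤ √N := Real.one_le_sqrt.mpr (by exact_mod_cast hn0.trans_le hnN)
  have hn1 : (1 : ℝ) ≤ n := by exact_mod_cast hn0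
  have hnK : 1 ≤ n * K := by nlinarith
  have hτ1 : τ ≤ √N := by
    refine le_trans ?_ hN
    rw [hτ, div_le_one (by positivity)]
    linarith
  have hmin := sigmaMin_mul_norm_le T h
  change ‖h‖ ≤ _
  rw [mul_assoc, div_mul_eq_mul_div, le_div_iff₀ hσmin, mul_comm ‖h‖]
  calc sigmaMin T * ‖h‖ ≤ 8 * n * K * (sigmaMax T * (√N + τ) * (2 * ε)) := hmin.trans hw
    _ ≤ 8 * n * K * (sigmaMax T * (√N + √N) * (2 * ε)) := by gcongr
    -- The constant 32 is within the 28 · 3 = 84 allowed by the claim.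
    _ = sigmaMax T * ((32 * √N * (n * K)) * ε) := by ring
    _ ≤ _ := by
        gcongr
        have e : 3 * (n : ℝ) * opNorm 1 2 T * opNorm 2 ∞ (pinv T) = 3 * (n * K) := by
          rw [hKdef]; ring
        rw [e]
        have : 0 ≤ √N * (n * K) := by positivity
        nlinarith

theorem eq_zero_of_isMinimizer (hT : Function.Injective T.mulVec)
    {Λ : Finset (Fin n)} {x xs xhat : Fin n → ℂ} {ε : ℝ} (hx : T *ᵥ x = 0)
    (h1 : vecNorm 2 (sample Λ (x - xs)) ≤ ε) (h2 : IsMinimizer T Λ xs ε xhat) :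
    xhat = x := by
  have h3 := isMinimizer_vecNorm_le h1 h2
  rw [hx] at h3
  have h4 : vecNorm 1 (T *ᵥ xhat) ≤ 0 := by simpa [vecNorm] using h3
  have h5 : T *ᵥ xhat = 0 := by
    have := norm_le_zero_iff.mp h4
    simpa using this
  exact hT (h5.trans hx.symm)

end Recovery

/-! ### From counting sample sequences to probability -/

section Sampling

variable {S : Type*} [MeasurableSpace S] {P : Measure S} {m n : ℕ}
  {ω : Fin m → S → Fin n}

theorem IsIIDUniform.measureReal_eq [IsProbabilityMeasure P] (h : IsIIDUniform P ω)
    (w : Fin m → Fin n) : P.real {o | (fun j => ω j o) = w} = (1 / (n : ℝ)) ^ m := by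
  have h1 : {o | (fun j => ω j o) = w} = ⋂ j ∈ (Finset.univ : Finset (Fin m)), ω j ⁻¹' {w j} := by
    ext o; simp [funext_iff]
  rw [h1, Measure.real, h.indep.measure_inter_preimage_eq_mul Finset.univ
    (fun j _ => MeasurableSet.singleton (w j)), ENNReal.toReal_prod]
  calc ∏ j, (P (ω j ⁻¹' {w j})).toReal = ∏ _j : Fin m, (1 / (n : ℝ)) :=
        Finset.prod_congr rfl fun j _ => h.uniform j (w j)
    _ = _ := by simp

/-- An event that contains all sample sequences outside `B` has probability at least
`1 - |B| / n ^ m`. -/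
theorem IsIIDUniform.one_sub_le_measureReal [IsProbabilityMeasure P] (h : IsIIDUniform P ω)
    (B : Finset (Fin m → Fin n)) {G : Set S} (hG : ∀ o, (fun j => ω j o) ∉ B → o ∈ G) :
    1 - (B.card : ℝ) * (1 / (n : ℝ)) ^ m ≤ P.real G := by
  have h1 : P.real (⋃ w ∈ B, {o | (fun j => ω j o) = w}) ≤ B.card * (1 / (n : ℝ)) ^ m := by
    refine (measureReal_biUnion_finset_le _ _).trans ?_
    simp only [h.measureReal_eq, Finset.sum_const, nsmul_eq_mul, le_refl]
  have h2 : (Set.univ : Set S) ⊆ G ∪ ⋃ w ∈ B, {o | (fun j => ω j o) = w} := fun o _ => by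
    by_cases ho : (fun j => ω j o) ∈ B
    · right; simpa using ho
    · exact Or.inl (hG o ho)
  have h3 := (measureReal_mono (μ := P) h2).trans (measureReal_union_le _ _)
  rw [probReal_univ] at h3
  linarith

end Sampling

/-! ### Failure fraction of one certificate -/

section FailureCount

variable {N n : ℕ} {T : Matrix (Fin N) (Fin n) ℂ}

/-- The failure fraction of a single certificate. -/
theorem failure_fraction_le {n N s K X : ℝ} (hn : 4 ≤ n) (hnN : n ≤ N) (hs : s ≤ N)
    (hK : 1 ≤ K) (hX : 10 * (Real.log N + Real.log K) ≤ X) :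
    4 * N * Real.exp (-(7 * Real.log N)) +
      √s / (1 / (8 * n * K)) * Real.exp (Real.log N - X) ≤ 2 / N ^ 3 := by
  have hN : 4 ≤ N := hn.trans hnN
  have hN0 : 0 < N := by linarith
  have hK0 : 0 < K := by linarith
  have e1 : Real.exp (-(7 * Real.log N)) = 1 / N ^ 7 := by
    rw [Real.exp_neg, show (7 : ℝ) * Real.log N = (7 : ℕ) * Real.log N by norm_num,
      Real.exp_nat_mul, Real.exp_log hN0, one_div]
  have e2 : Real.exp (Real.log N - X) ≤ 1 / (N ^ 9 * K) := by
    have hlK : 0 ≤ Real.log K := Real.log_nonneg hK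
    calc Real.exp (Real.log N - X) ≤ Real.exp (-((9 : ℕ) * Real.log N + Real.log K)) := by
          gcongr; push_cast; linarith
      _ = _ := by
          rw [Real.exp_neg, Real.exp_add, Real.exp_nat_mul, Real.exp_log hN0, Real.exp_log hK0,
            one_div]
  have hsqrt : √s ≤ N := by
    rw [Real.sqrt_le_left hN0.le]; nlinarith
  have h1 : 4 * N * (1 / N ^ 7) ≤ 1 / N ^ 3 := by
    rw [mul_one_div, div_le_div_iff₀ (by positivity) (by positivity)]
    have : (4 : ℝ) ^ 3 ≤ N ^ 3 := by gcongr
    have h4 : 0 < N ^ 4 := by positivity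
    nlinarith
  have h2 : √s / (1 / (8 * n * K)) * Real.exp (Real.log N - X) ≤ 1 / N ^ 3 := by
    calc √s / (1 / (8 * n * K)) * Real.exp (Real.log N - X)
        = √s * (8 * n * K) * Real.exp (Real.log N - X) := by rw [div_div_eq_mul_div, div_one]
      _ ≤ N * (8 * N * K) * (1 / (N ^ 9 * K)) := by gcongr
      _ = 8 / N ^ 7 := by field_simp
      _ ≤ 1 / N ^ 3 := by
          rw [div_le_div_iff₀ (by positivity) (by positivity)]
          have : (4 : ℝ) ^ 4 ≤ N ^ 4 := by gcongr
          have h4 : 0 < N ^ 3 := by positivity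
          nlinarith
  rw [e1]
  calc _ ≤ 1 / N ^ 3 + 1 / N ^ 3 := add_le_add h1 h2
    _ = _ := by ring

open Classical in
/-- The sample sequences for which there is no certificate for `q₀`. -/
noncomputable def badSamples (T : Matrix (Fin N) (Fin n) ℂ) (J : Finset (Fin N))
    (q₀ : EuclideanSpace ℂ (Fin N)) (τ : ℝ) (m : ℕ) : Finset (Fin m → Fin n) :=
  Finset.univ.filter fun ω => ¬ ∃ y, IsCertificate (adjointEntry T) J q₀ τ (Set.range ω) y

theorem exists_certificate_of_notMem_badSamples {J : Finset (Fin N)}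
    {q₀ : EuclideanSpace ℂ (Fin N)} {τ : ℝ} {m : ℕ} {ω : Fin m → Fin n}
    (h : ω ∉ badSamples T J q₀ τ m) :
    ∃ y, IsCertificate (adjointEntry T) J q₀ τ (distinctIndices ω : Set (Fin n)) y := by
  have e : ((distinctIndices ω : Finset (Fin n)) : Set (Fin n)) = Set.range ω := by
    simp [distinctIndices]
  rw [e]
  simpa [badSamples] using h

/-- Taking `Λ = log N` makes the entry term of order `N⁻⁶`. The constant is 288000 = 10 · 9600 · 3:
contraction rate `1 / (9600 M)`, `M ≤ 3 μ |J|`, and a residual exponent of `10 (log N + log K)`,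
enough to beat `exp Λ` and `√|J| / τ`. -/
theorem card_badSamples_le (hn : 4 ≤ n) (hnN : n ≤ N) (hT : Function.Injective T.mulVec) {γ : ℝ}
    (hγ : 0 < γ) (hdev : deviation T γ ≤ 1) {J : Finset (Fin N)} (hJ : J.Nonempty)
    (hμ : 1 ≤ incoherence T γ * J.card) {q₀ : EuclideanSpace ℂ (Fin N)} (hq : restrict J q₀ = q₀)
    (hq1 : ∀ a, ‖q₀ a‖ ≤ 1) {m : ℕ}
    (hm : 288000 * (incoherence T γ * J.card) *
      (Real.log N + Real.log (opNorm 1 2 T * opNorm 2 ∞ (pinv T))) ≤ m) :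
    ((badSamples T J q₀ (1 / (8 * n * (opNorm 1 2 T * opNorm 2 ∞ (pinv T)))) m).card : ℝ) ≤
      (n : ℝ) ^ m * (2 / (N : ℝ) ^ 3) := by
  set K := opNorm 1 2 T * opNorm 2 ∞ (pinv T)
  have hK : 1 ≤ K := one_le_opNorm_mul_opNorm (by omega) hT
  have hn4 : (4 : ℝ) ≤ n := by exact_mod_cast hn
  have hnN' : (n : ℝ) ≤ N := by exact_mod_cast hnN
  have hN4 : (4 : ℝ) ≤ N := hn4.trans hnN'
  have : Nonempty (Fin n) := ⟨⟨0, by omega⟩⟩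
  have : Nonempty (Fin N) := ⟨⟨0, by omega⟩⟩
  have hΛ : 1 ≤ Real.log N := by
    rw [Real.le_log_iff_exp_le (by linarith)]
    linarith [Real.exp_one_lt_d9]
  set M := 1 + 2 * incoherence T γ * J.card with hM
  have hM3 : M ≤ 3 * (incoherence T γ * J.card) := by linarith
  have hM0 : 0 < M := by linarith
  have hcard := card_no_certificate_le (isIncoherent_analysisVec_dualVec hγ hdev) hJ hM hΛ
    (L := adjointEntry T) (adjointEntry_dualVec hT γ) (adjointEntry_frameOp hT hγ) hq
    (norm_le_sqrt_card_of_restrict hq hq1) (τ := 1 / (8 * n * K)) (by positivity) m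
  rw [Fintype.card_fin, Fintype.card_fin] at hcard
  refine hcard.trans ?_
  gcongr
  refine failure_fraction_le hn4 hnN' ?_ hK ?_
  · exact_mod_cast (Finset.card_le_univ J).trans_eq (Fintype.card_fin N)
  · have hl : 0 ≤ Real.log N + Real.log K := add_nonneg (by linarith) (Real.log_nonneg hK)
    rw [le_div_iff₀ (by positivity)]
    calc 10 * (Real.log N + Real.log K) * (9600 * M)
        ≤ 10 * (Real.log N + Real.log K) * (9600 * (3 * (incoherence T γ * J.card))) := by gcongr
      _ = 288000 * (incoherence T γ * J.card) * (Real.log N + Real.log K) := by ring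
      _ ≤ m := hm

theorem incoherence_nonneg (T : Matrix (Fin N) (Fin n) ℂ) (γ : ℝ) : 0 ≤ incoherence T γ :=
  Real.iSup_nonneg fun _ => le_max_of_le_left (by positivity)

theorem le_of_injective (hT : Function.Injective T.mulVec) : n ≤ N := by
  simpa using LinearMap.finrank_le_finrank_of_injective (toEuclideanLin_injective hT)

theorem deviation_nonneg (T : Matrix (Fin N) (Fin n) ℂ) (γ : ℝ) : 0 ≤ deviation T γ :=
  opNorm_nonneg _

end FailureCount

end AnalysisSparsity

/-! ### Union bound over the targets -/

theorem theorem2 :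
    ∃ C : ℝ, 0 < C ∧
      ∀ (n N : ℕ), 0 < n →
      ∀ T : Matrix (Fin N) (Fin n) ℂ, Function.Injective T.mulVec →
      ∀ γ : ℝ, AnalysisSparsity.IsOptimalScaling T γ →
      ∀ (x : Fin n → ℂ) (s : ℕ), AnalysisSparsity.numNonzero (T *ᵥ x) ≤ s →
      ∀ (β : ℝ) (m : ℕ),
        C * (1 + β) * AnalysisSparsity.incoherence T γ * (s : ℝ) /
            (1 - AnalysisSparsity.deviation T γ) *
          (Real.log N +
            Real.log (AnalysisSparsity.opNorm 1 2 T *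
              AnalysisSparsity.opNorm 2 ∞ (AnalysisSparsity.pinv T))) ≤ (m : ℝ) →
      ∀ (S : Type*) [MeasurableSpace S] (P : Measure S) [IsProbabilityMeasure P]
        (ω : Fin m → S → Fin n), AnalysisSparsity.IsIIDUniform P ω →
        1 - Real.exp (-β) - 3 / (n : ℝ) ≤
          P.real {o : S |
            ∀ (ε : ℝ) (xs xhat : Fin n → ℂ),
              AnalysisSparsity.vecNorm 2 (AnalysisSparsity.sample
                (AnalysisSparsity.distinctIndices fun j => ω j o) (x - xs)) ≤ ε →
              AnalysisSparsity.IsMinimizer T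
                (AnalysisSparsity.distinctIndices fun j => ω j o) xs ε xhat →
              AnalysisSparsity.vecNorm 2 (xhat - x) ≤
                AnalysisSparsity.sigmaMax T / AnalysisSparsity.sigmaMin T *
                  (2 + 28 * √(N : ℝ) *
                    (3 * (n : ℝ) * AnalysisSparsity.opNorm 1 2 T *
                      AnalysisSparsity.opNorm 2 ∞ (AnalysisSparsity.pinv T) + 1)) * ε} := by
  open AnalysisSparsity in
  refine ⟨288000, by norm_num, ?_⟩
  intro n N hn T hT γ hγ x s hs β m hm S _ P _ ω hω
  have hn0 : (0 : ℝ) < n := by exact_mod_cast hn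
  -- For `β ≤ 0`, and likewise for `n ≤ 3`, the claimed lower bound on the probability is not
  -- positive.
  rcases le_or_gt β 0 with hβ | hβ
  · refine le_trans ?_ measureReal_nonneg
    have h1 : 1 ≤ Real.exp (-β) := Real.one_le_exp (by linarith)
    have h2 : 0 ≤ 3 / (n : ℝ) := by positivity
    linarith
  rcases lt_or_ge n 4 with hn4 | hn4
  · refine le_trans ?_ measureReal_nonneg
    have h1 : 1 ≤ 3 / (n : ℝ) := by
      rw [one_le_div hn0]; exact_mod_cast Nat.le_of_lt_succ hn4
    have h2 := Real.exp_pos (-β)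
    linarith
  -- With empty support there is nothing to certify: a minimizer has `T x̂ = 0`, so `x̂ = x` by
  -- injectivity.
  by_cases hx : T *ᵥ x = 0
  · refine le_trans ?_ (hω.one_sub_le_measureReal ∅ fun o _ => ?_)
    · have h1 := Real.exp_pos (-β)
      have h2 : 0 ≤ 3 / (n : ℝ) := by positivity
      simp
      linarith
    · intro ε xs xhat h1 h2
      have hε : 0 ≤ ε := (vecNorm_nonneg _).trans h1
      rw [eq_zero_of_isMinimizer hT hx h1 h2]
      have h3 : vecNorm 2 (x - x) = 0 := by simp [vecNorm]
      rw [h3]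
      have h4 := sigmaMax_nonneg T
      have h5 := sigmaMin_pos hn hT
      have h6 : 0 ≤ opNorm 1 2 T := opNorm_nonneg _
      have h7 : 0 ≤ opNorm 2 ∞ (pinv T) := opNorm_nonneg _
      positivity
  set J : Finset (Fin N) := Finset.univ.filter fun a => (T *ᵥ x) a ≠ 0 with hJdef
  have hJ0 : ∀ a ∉ J, (T *ᵥ x) a = 0 := fun a ha => by simpa [hJdef] using ha
  have hJne : J.Nonempty := by
    by_contra hne
    rw [Finset.not_nonempty_iff_eq_empty] at hne
    exact hx (funext fun a => hJ0 a (by simp [hne]))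
  have hJs : (J.card : ℝ) ≤ s := by exact_mod_cast hs
  have hdev := deviation_lt_one hn hT hγ
  have hdev0 := deviation_nonneg T γ
  have hnN := le_of_injective hT
  have hμ0 := incoherence_nonneg T γ
  have hμ : 1 ≤ incoherence T γ * J.card := by
    have : Nonempty (Fin n) := ⟨⟨0, hn⟩⟩
    refine (isIncoherent_analysisVec_dualVec hγ.1 hdev.le).one_le_mul_card
      (w := T.toEuclideanLin (WithLp.toLp 2 x)) (fun h0 => hx ?_) hJ0 ?_
    · simpa [Matrix.toLpLin_apply] using h0
    · rw [frameOp_analysisVec_dualVec hγ.1, adjoint_pinv_adjoint_toEuclideanLin hT]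
  set K := opNorm 1 2 T * opNorm 2 ∞ (pinv T) with hKdef
  have hl : 0 ≤ Real.log N + Real.log K :=
    add_nonneg (Real.log_natCast_nonneg N)
      (Real.log_nonneg (one_le_opNorm_mul_opNorm hn hT))
  have hm' : 288000 * (incoherence T γ * J.card) * (Real.log N + Real.log K) ≤ m := by
    refine le_trans ?_ hm
    gcongr
    calc 288000 * (incoherence T γ * J.card) ≤ 288000 * (1 + β) * incoherence T γ * s := by
          have : incoherence T γ * J.card ≤ (1 + β) * (incoherence T γ * s) := by
            calc incoherence T γ * J.card ≤ 1 * (incoherence T γ * s) := by rw [one_mul]; gcongr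
              _ ≤ _ := by gcongr; linarith
          linarith
      -- The factors `1 + β` and `1 / (1 - deviation)` are both at least 1.
      _ ≤ _ := le_div_self (by positivity) (by linarith) (by linarith)
  set τ := 1 / (8 * n * K) with hτ
  set B : Finset (Fin m → Fin n) := badSamples T J (signVec (WithLp.toLp 2 (T *ᵥ x))) τ m ∪
    Finset.univ.biUnion fun k => badSamples T J (rowTarget T J k) τ m with hB
  have hBcard : (B.card : ℝ) ≤ (n + 1) * ((n : ℝ) ^ m * (2 / (N : ℝ) ^ 3)) := by
    have h1 := card_badSamples_le hn4 hnN hT hγ.1 hdev.le hJne hμ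
      (restrict_signVec (t := WithLp.toLp 2 (T *ᵥ x)) hJ0) (norm_signVec_apply_le _) hm'
    have h2 := fun k => card_badSamples_le hn4 hnN hT hγ.1 hdev.le hJne hμ
      (q₀ := rowTarget T J k) (restrict_restrict J _) (norm_rowTarget_apply_le J k) hm'
    calc (B.card : ℝ) ≤ (badSamples T J (signVec (WithLp.toLp 2 (T *ᵥ x))) τ m).card +
          ∑ k, ((badSamples T J (rowTarget T J k) τ m).card : ℝ) := by
          exact_mod_cast (Finset.card_union_le _ _).trans
            (Nat.add_le_add_left Finset.card_biUnion_le _)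
      _ ≤ (n : ℝ) ^ m * (2 / (N : ℝ) ^ 3) + ∑ _k : Fin n, (n : ℝ) ^ m * (2 / (N : ℝ) ^ 3) :=
          add_le_add h1 (Finset.sum_le_sum fun k _ => h2 k)
      _ = _ := by
          rw [Finset.sum_const, Finset.card_univ, Fintype.card_fin, nsmul_eq_mul]; ring
  refine le_trans ?_ (hω.one_sub_le_measureReal B fun o ho => ?_)
  · have h1 : (B.card : ℝ) * (1 / (n : ℝ)) ^ m ≤ 3 / n := by
      calc (B.card : ℝ) * (1 / (n : ℝ)) ^ m
          ≤ (n + 1) * ((n : ℝ) ^ m * (2 / (N : ℝ) ^ 3)) * (1 / (n : ℝ)) ^ m := by gcongr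
        _ = (n + 1) * (2 / (N : ℝ) ^ 3) := by
            rw [one_div, inv_pow]; field_simp
        -- Each of the `n + 1` targets fails with probability at most `2 / N³`, so `n ≤ N` gives a
        -- total within `3 / n`.
        _ ≤ (n + 1) * (2 / (n : ℝ) ^ 3) := by gcongr
        _ ≤ 3 / n := by
            rw [mul_div_assoc', div_le_div_iff₀ (by positivity) hn0]
            have h4 : (4 : ℝ) ≤ n := by exact_mod_cast hn4
            have : 0 ≤ (n : ℝ) * (3 * n + 2) * (n - 4) := by
              have : 0 ≤ (n : ℝ) - 4 := by linarith
              positivity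
            nlinarith
    have h2 := Real.exp_pos (-β)
    linarith
  · intro ε xs xhat h1 h2
    rw [hB, Finset.mem_union, not_or] at ho
    refine vecNorm_sub_le_of_certificates hn4 hnN hT hJ0 hτ
      (exists_certificate_of_notMem_badSamples ho.1) (fun k => ?_) h1 h2
    exact exists_certificate_of_notMem_badSamples fun hk =>
      ho.2 (Finset.mem_biUnion.mpr ⟨k, Finset.mem_univ k, hk⟩)
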